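/- Let $\theta\in\mathbb R$ with $\sin\theta\neq 0$. Put $a=\tfrac12\cot\theta$, $b=\csc\theta$, $c(\theta)=\sqrt{\frac{1-i\cot\theta}{2\pi}}$ (principal root), $\Delta=2\pi|\sin\theta|$, $\lambda_\theta(t)=e^{iat^2}$ and $K_\theta(t,\xi)=c(\theta)e^{ia(t^2+\xi^2)-ibt\xi}$. Let $\hat f_\theta(\xi)=\int_{\mathbb R}f(t)K_\theta(t,\xi)\,dt$ denote the fractional Fourier transform, extended to a unitary operator of $L^2(\mathbb R)$. Let $\phi:\mathbb R\to\mathbb C$ be a square integrable function, defined everywhere, and write $\vec\phi(t)=\lambda_\theta(t)\phi(t)$. Assume that there are constants $B\ge A>0$ with $$A\le G_{\phi,\theta}(\xi):=\sum_{n\in\mathbb Z}|\hat\phi_\theta(\xi+n\Delta)|^2\le B\quad\text{for a.e. }\xi\in[0,\Delta],$$ and that $C_{\phi,\theta}(t):=\sum_{n\in\mathbb Z}|\vec\phi(t-n)|^2<\infty$ for every $t\in\mathbb R$. Let $V_\theta(\phi)$ be the closed linear span in $L^2(\mathbb R)$ of the functions $g_n(t)=c(\theta)\overline{\lambda_\theta(t)}\,\vec\phi(t-n)$,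 $n\in\mathbb Z$. Every $f\in V_\theta(\phi)$ is regarded as a function defined everywhere: there is exactly one function $f:\mathbb R\to\mathbb C$ for which there is $d\in\ell^2(\mathbb Z)$ such that $\sum_n d(n)g_n$ converges to the given element in $L^2(\mathbb R)$ and to $f(t)$ at every point $t\in\mathbb R$. Let $0\le\sigma<1$, and let $$Z_{\phi,\theta}(\sigma,\xi)=\sum_{n\in\mathbb Z}\vec\phi(\sigma-n)\lambda_\theta(n)\overline{K_\theta(n,\xi)}$$ be the fractional Zak transform, where the series converges in $L^2$ with respect to $\xi$ on every bounded interval. A sequence $\{x_n\}_{n\in\mathbb Z}$ in a Hilbert space $H$ is a frame of $H$ if, for some $0<A'\le B'$, $A'\|x\|^2\le\sum_n|\langle x,x_n\rangle|^2\le B'\|x\|^2$ for all $x\in H$. It is a Riesz basis of $H$ if its span is dense in $H$ and, for some $0<A'\le B'$, $A'\|d\|^2\le\|\sum_n d(n)x_n\|^2\le B'\|d\|^2$ for all $d\in\ell^2(\mathbb Z)$. **Theorem.** The following are equivalent. (a) There is a frame $\{S_n\}_{n\in\mathbb Z}$ of $V_\theta(\phi)$ with $$f(t)=\sum_{n\in\mathbb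 Z}f(\sigma+n)S_n(t)\qquad(f\in V_\theta(\phi),\ t\in\mathbb R).\tag{1}$$ (b) There is a Riesz basis $\{S_n\}_{n\in\mathbb Z}$ of $V_\theta(\phi)$ with (1). (c) There are constants $\beta\ge\alpha>0$ with $\alpha\le|Z_{\phi,\theta}(\sigma,\xi)|\le\beta$ for a.e. $\xi\in[0,\Delta]$. In this case, for every frame and every Riesz basis $\{S_n\}$ as in (a) and (b), the series (1) converges to $f$ in $L^2(\mathbb R)$, and uniformly on every subset of $\mathbb R$ on which $C_{\phi,\theta}$ is bounded. Moreover there is $S\in V_\theta(\phi)$ with $$\hat S_\theta(\xi)=\frac{\overline{c(\theta)}\,\hat\phi_\theta(\xi)}{\lambda_\theta(\xi)Z_{\phi,\theta}(\sigma,\xi)}\quad\text{for a.e. }\xi\in\mathbb R,$$ such that $$S_n(t)=\overline{\lambda_\theta(t)}\,\lambda_\theta(\sigma+n)\,\lambda_\theta(t-n)\,S(t-n)\qquad(n\in\mathbb Z,\ t\in\mathbb R),$$ and $S_n(\sigma+k)=\delta_{n,k}$ for all $n,k\in\mathbb Z$. -/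

import Mathlib

open MeasureTheory Filter Topology
open scoped ENNReal NNReal FourierTransform ComplexConjugate

namespace FrFT

noncomputable section

/-! ### Frames and Riesz bases -/

/-- `v` is a frame of the Hilbert space `H`. -/
def IsFrame {H : Type*} [NormedAddCommGroup H] [InnerProductSpace ℂ H] (v : ℤ → H) : Prop :=
  ∃ A B : ℝ, 0 < A ∧ A ≤ B ∧ ∀ x : H,
    Summable (fun n => ‖inner ℂ x (v n)‖ ^ 2) ∧
    A * ‖x‖ ^ 2 ≤ ∑' n, ‖inner ℂ x (v n)‖ ^ 2 ∧
    ∑' n, ‖inner ℂ x (v n)‖ ^ 2 ≤ B * ‖x‖ ^ 2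

/-- `v` is a Riesz basis of the Hilbert space `H`: it is complete, and
`A ‖c‖² ≤ ‖∑ c(n) v n‖² ≤ B ‖c‖²` for all square summable `c`. -/
def IsRieszBasis {H : Type*} [NormedAddCommGroup H] [InnerProductSpace ℂ H] (v : ℤ → H) : Prop :=
  (Submodule.span ℂ (Set.range v)).topologicalClosure = ⊤ ∧
  ∃ A B : ℝ, 0 < A ∧ A ≤ B ∧ ∀ c : ℤ → ℂ, Summable (fun n => ‖c n‖ ^ 2) →
    Summable (fun n => c n • v n) ∧
    A * ∑' n, ‖c n‖ ^ 2 ≤ ‖∑' n, c n • v n‖ ^ 2 ∧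
    ‖∑' n, c n • v n‖ ^ 2 ≤ B * ∑' n, ‖c n‖ ^ 2

/-! ### The fractional Fourier transform -/

/-- `a(θ) = cot θ / 2`. -/
def a (θ : ℝ) : ℝ := Real.cot θ / 2

/-- `b(θ) = csc θ`. -/
def b (θ : ℝ) : ℝ := (Real.sin θ)⁻¹

/-- `c(θ) = √((1 - i cot θ) / 2π)`, with the principal square root. -/
def c (θ : ℝ) : ℂ := ((1 - Complex.I * (Real.cot θ : ℂ)) / (2 * (Real.pi : ℂ))) ^ (1 / 2 : ℂ)

/-- `Δ = 2π |sin θ|`. -/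
def Δ (θ : ℝ) : ℝ := 2 * Real.pi * |Real.sin θ|

/-- The chirp `λ_θ(t) = exp(i a t²)`. -/
def chirp (θ t : ℝ) : ℂ := Complex.exp (Complex.I * ((a θ * t ^ 2 : ℝ) : ℂ))

/-- The kernel `K_θ(t, ξ) = c(θ) exp(i a (t² + ξ²) - i b t ξ)` (for `θ ∉ πℤ`). -/
def K (θ t ξ : ℝ) : ℂ :=
  c θ * Complex.exp (Complex.I * ((a θ * (t ^ 2 + ξ ^ 2) : ℝ) : ℂ)
    - Complex.I * ((b θ * t * ξ : ℝ) : ℂ))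

/-- The chirp-modulated version `λ_θ(t) f(t)` of `f`. -/
def modulate (θ : ℝ) (f : ℝ → ℂ) (t : ℝ) : ℂ := chirp θ t * f t

/-- `η_θ(t) = c(θ) * conj λ_θ(t)`. -/
def eta (θ t : ℝ) : ℂ := c θ * conj (chirp θ t)

lemma norm_chirp (θ t : ℝ) : ‖chirp θ t‖ = 1 := by
  rw [chirp, mul_comm]; exact Complex.norm_exp_ofReal_mul_I _

lemma continuous_chirp (θ : ℝ) : Continuous (chirp θ) := by
  unfold chirp; fun_prop

lemma memLp_mul_of_continuous {u f : ℝ → ℂ} {M : ℝ} (hu : Continuous u) (hM : ∀ t, ‖u t‖ ≤ M)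
    (hf : MemLp f 2) : MemLp (fun t => u t * f t) 2 := by
  refine hf.of_le_mul (c := M) (hu.aestronglyMeasurable.mul hf.aestronglyMeasurable) ?_
  refine Eventually.of_forall fun t => ?_
  rw [norm_mul]
  exact mul_le_mul_of_nonneg_right (hM t) (norm_nonneg _)

lemma memLp_modulate (θ : ℝ) {f : ℝ → ℂ} (hf : MemLp f 2) : MemLp (modulate θ f) 2 :=
  memLp_mul_of_continuous (continuous_chirp θ) (fun t => (norm_chirp θ t).le) hf

/-- The fractional Fourier transform on `L²(ℝ)`, i.e. the extension to `L²` of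
`f ↦ ∫ f(t) K_θ(t, ·) dt`.  Since
`∫ f(t) K_θ(t, ξ) dt = c(θ) λ_θ(ξ) ∫ λ_θ(t) f(t) exp(-i b t ξ) dt`, it is
`c(θ) λ_θ(ξ) (𝓕 (λ_θ f)) (b ξ / 2π)`, where `𝓕 g (w) = ∫ g(t) exp(-2π i t w) dt` on `L²`. -/
def frft (θ : ℝ) (f : Lp ℂ 2 (volume : Measure ℝ)) (ξ : ℝ) : ℂ :=
  c θ * chirp θ ξ *
    (𝓕 ((memLp_modulate θ (Lp.memLp f)).toLp (modulate θ f)) : Lp ℂ 2 (volume : Measure ℝ))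
      (b θ * ξ / (2 * Real.pi))

/-! ### The functions `C`, `G` and the fractional Zak transform -/

/-- `C_{φ,θ}(t) = ∑ₙ |λ_θ(t - n) φ(t - n)|²`, with values in `[0, ∞]`. -/
def C (θ : ℝ) (φ : ℝ → ℂ) (t : ℝ) : ℝ≥0∞ := ∑' n : ℤ, ‖modulate θ φ (t - n)‖ₑ ^ 2

/-- `G_{φ,θ}(ξ) = ∑ₙ |φ̂_θ(ξ + n Δ)|²`, with values in `[0, ∞]`. -/
def G (θ : ℝ) {φ : ℝ → ℂ} (hφ : MemLp φ 2) (ξ : ℝ) : ℝ≥0∞ :=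
  ∑' n : ℤ, ‖frft θ (hφ.toLp φ) (ξ + n * Δ θ)‖ₑ ^ 2

/-- `z` is (a version of) the fractional Zak transform `Z_{φ,θ}(t, ·)`: the series
`∑ₙ λ_θ(t - n) φ(t - n) λ_θ(n) conj K_θ(n, ξ)` converges to `z(ξ)` in `L²` on bounded intervals. -/
def IsZak (θ : ℝ) (φ : ℝ → ℂ) (t : ℝ) (z : ℝ → ℂ) : Prop :=
  AEStronglyMeasurable z volume ∧ ∀ R : ℝ,
    Tendsto (fun s : Finset ℤ => eLpNorm (fun ξ =>
        ∑ n ∈ s, modulate θ φ (t - n) * chirp θ n * conj (K θ n ξ) - z ξ) 2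
      (volume.restrict (Set.Icc (-R) R))) atTop (𝓝 0)

open Classical in
/-- The fractional Zak transform `Z_{φ,θ}(t, ·)`, as a function on `ℝ` determined almost
everywhere. -/
def zak (θ : ℝ) (φ : ℝ → ℂ) (t : ℝ) : ℝ → ℂ :=
  if h : ∃ z, IsZak θ φ t z then h.choose else 0

/-! ### The chirp-modulated shift-invariant space -/

/-- The generators `η_θ(t) λ_θ(t - n) φ(t - n)` of `V_θ(φ)`. -/
def gen (θ : ℝ) (φ : ℝ → ℂ) (n : ℤ) (t : ℝ) : ℂ := eta θ t * modulate θ φ (t - n)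

lemma memLp_gen (θ : ℝ) {φ : ℝ → ℂ} (hφ : MemLp φ 2) (n : ℤ) : MemLp (gen θ φ n) 2 := by
  refine memLp_mul_of_continuous (u := eta θ) (M := ‖c θ‖) ?_ ?_ ?_
  · exact continuous_const.mul (Complex.continuous_conj.comp (continuous_chirp θ))
  · intro t
    simp [eta, norm_chirp]
  · exact (memLp_modulate θ hφ).comp_measurePreserving
      (measurePreserving_sub_right volume (n : ℝ))

/-- The generators as elements of `L²(ℝ)`. -/
def genLp (θ : ℝ) {φ : ℝ → ℂ} (hφ : MemLp φ 2) (n : ℤ) : Lp ℂ 2 (volume : Measure ℝ) :=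
  (memLp_gen θ hφ n).toLp (gen θ φ n)

/-- `V_θ(φ)`, the closed linear span in `L²(ℝ)` of the functions `η_θ(t) λ_θ(t - n) φ(t - n)`. -/
def V (θ : ℝ) {φ : ℝ → ℂ} (hφ : MemLp φ 2) : Submodule ℂ (Lp ℂ 2 (volume : Measure ℝ)) :=
  (Submodule.span ℂ (Set.range (genLp θ hφ))).topologicalClosure

/-- The function `f`, defined everywhere on `ℝ`, is the element `F` of `V_θ(φ)` regarded as a
function: for some square summable `d`, `F = ∑ d(n) η_θ(·) λ_θ(· - n) φ(· - n)` in `L²(ℝ)` and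
`f` is the sum of this series at every point. -/
def Represents (θ : ℝ) {φ : ℝ → ℂ} (hφ : MemLp φ 2) (F : V θ hφ) (f : ℝ → ℂ) : Prop :=
  ∃ d : ℤ → ℂ, Summable (fun n => ‖d n‖ ^ 2) ∧
    HasSum (fun n => d n • genLp θ hφ n) (F : Lp ℂ 2 (volume : Measure ℝ)) ∧
    ∀ t, HasSum (fun n => d n * gen θ φ n t) (f t)

open Classical in
/-- The values of an element of `V_θ(φ)` at the points of `ℝ`. -/
def value (θ : ℝ) {φ : ℝ → ℂ} (hφ : MemLp φ 2) (F : V θ hφ) : ℝ → ℂ :=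
  if h : ∃ f, Represents θ hφ F f then h.choose else 0

/-- The sampling expansion `f(t) = ∑ₙ f(σ + n) Sₙ(t)`, for all `f ∈ V_θ(φ)` and all `t`. -/
def IsSamplingExpansion (θ : ℝ) {φ : ℝ → ℂ} (hφ : MemLp φ 2) (σ : ℝ) (S : ℤ → V θ hφ) : Prop :=
  ∀ (f : V θ hφ) (t : ℝ),
    HasSum (fun n : ℤ => value θ hφ f (σ + n) * value θ hφ (S n) t) (value θ hφ f t)

end

end FrFT

/-! All questions are moved to `L²` of the circle, where sampling becomes multiplication by one
function. Put `F = 𝓕 (λ_θ φ)`. A translate becomes a modulation under `𝓕`, so `f ↦ 𝓕 (λ_θ f)`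
carries the generator `g_n` to `c(θ) exp(-2πi n w) F(w)`. The bounds on `G` are bounds on the
periodization of `|F|²`, hence `D ↦ c(θ) D(-w) F(w)`, followed by the inverse of that transform, is
an isomorphism of `L²` of the circle onto `V_θ(φ)` taking the Fourier basis to the generators
(`synthEquiv`). Finiteness of `C` makes the evaluation at `t` an inner product with `kernel t`, of
squared norm `|c(θ)|² C(t)`.

Let `P` be the Fourier series with coefficients `λ_θ(σ + n) φ(σ + n)` (`symbol`). The sample at `σ +
n` of the function belonging to `D` is a convolution, namely `η_θ(σ + n)` times the `n`-th Fourier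
coefficient of `D P` (`hasSum_convolution`), and `|η_θ| = |c(θ)|` is constant. Moreover `|Z(σ, ξ)| =
|c(θ)| |P(κ ξ)|` with `κ = -b / 2π` (`zak_ae_eq`), so (c) says that `|P|` lies between positive
constants.

The equivalence is then a statement about multiplication by `P` (`SamplingSystem`). If `|P|` is
bounded above and below, the functions `e_n / (w_n P)`, with `w_n = η_θ(σ + n)`, are the image of a
scaled orthonormal basis under an isomorphism, and they give the expansion. Conversely, an expansion
along a Bessel sequence bounds `‖D‖` by a multiple of `‖D P‖`, so `|P|` is bounded below. The
functions `e_n / (w_n P)` are then defined and interpolate, which forces the given sequence to be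
this one. Finally the lower frame or Riesz bound bounds `|1 / P|` below, that is, `|P|` above. The
remaining claims are read off from the formula for the interpolating functions. -/

namespace FrFT

noncomputable section

/-! ### Frames and Riesz bases under isomorphisms -/

section Frames

variable {H H' : Type*} [NormedAddCommGroup H] [InnerProductSpace ℂ H]
  [NormedAddCommGroup H'] [InnerProductSpace ℂ H']

/-- The coefficients of `x` against `e (v n)` are those of `e* x` against `v n`, and `e*` is bounded
below because the adjoint of `e⁻¹` inverts it. -/
lemma IsFrame.map [CompleteSpace H] [CompleteSpace H'] {v : ℤ → H} (hv : IsFrame v)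
    (e : H ≃L[ℂ] H') : IsFrame (fun n => e (v n)) := by
  obtain ⟨A, B, hA, hAB, h⟩ := hv
  -- Adding `1` keeps the constants positive even on the zero space.
  set M := ‖(e : H →L[ℂ] H')‖ + 1 with hM
  set N := ‖(e.symm : H' →L[ℂ] H)‖ + 1 with hN
  have hM0 : 0 < M := by positivity
  have hN0 : 0 < N := by positivity
  let T := ContinuousLinearMap.adjoint (e : H →L[ℂ] H')
  let T' := ContinuousLinearMap.adjoint (e.symm : H' →L[ℂ] H)
  have hin : ∀ (x : H') n, inner ℂ x (e (v n)) = inner ℂ (T x) (v n) := fun x n =>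
    (ContinuousLinearMap.adjoint_inner_left (e : H →L[ℂ] H') (v n) x).symm
  have hTx : ∀ x, ‖T x‖ ≤ M * ‖x‖ := fun x => by
    refine (T.le_opNorm x).trans (mul_le_mul_of_nonneg_right ?_ (norm_nonneg _))
    simp only [T, LinearIsometryEquiv.norm_map, hM]; linarith
  have hT'T : ∀ x, T' (T x) = x := fun x => by
    refine ext_inner_right ℂ fun y => ?_
    rw [ContinuousLinearMap.adjoint_inner_left, ContinuousLinearMap.adjoint_inner_left]
    simp
  have hxT : ∀ x, ‖x‖ ≤ N * ‖T x‖ := fun x => by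
    calc ‖x‖ = ‖T' (T x)‖ := by rw [hT'T]
      _ ≤ ‖T'‖ * ‖T x‖ := T'.le_opNorm _
      _ ≤ N * ‖T x‖ := by
        refine mul_le_mul_of_nonneg_right ?_ (norm_nonneg _)
        simp only [T', LinearIsometryEquiv.norm_map, hN]; linarith
  -- The maximum makes the required order of the two bounds immediate.
  refine ⟨A / N ^ 2, max (A / N ^ 2) (B * M ^ 2), by positivity, le_max_left _ _, fun x => ?_⟩
  simp_rw [hin]
  obtain ⟨h1, h2, h3⟩ := h (T x)
  refine ⟨h1, le_trans ?_ h2, h3.trans ?_⟩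
  · rw [div_mul_eq_mul_div, div_le_iff₀ (by positivity)]
    have := pow_le_pow_left₀ (norm_nonneg _) (hxT x) 2
    calc A * ‖x‖ ^ 2 ≤ A * (N * ‖T x‖) ^ 2 := by gcongr
      _ = _ := by ring
  · have := pow_le_pow_left₀ (norm_nonneg _) (hTx x) 2
    have hB : 0 ≤ B := hA.le.trans hAB
    calc B * ‖T x‖ ^ 2 ≤ B * (M * ‖x‖) ^ 2 := by gcongr
      _ = B * M ^ 2 * ‖x‖ ^ 2 := by ring
      _ ≤ _ := by gcongr; exact le_max_right _ _

lemma IsRieszBasis.map {v : ℤ → H} (hv : IsRieszBasis v)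
    (e : H ≃L[ℂ] H') : IsRieszBasis (fun n => e (v n)) := by
  obtain ⟨hd, A, B, hA, hAB, h⟩ := hv
  set M := ‖(e : H →L[ℂ] H')‖ + 1 with hM
  set N := ‖(e.symm : H' →L[ℂ] H)‖ + 1 with hN
  have hM0 : 0 < M := by positivity
  have hN0 : 0 < N := by positivity
  have hex : ∀ x, ‖e x‖ ≤ M * ‖x‖ := fun x => by
    refine ((e : H →L[ℂ] H').le_opNorm x).trans
      (mul_le_mul_of_nonneg_right ?_ (norm_nonneg _))
    linarith
  have hxe : ∀ x, ‖x‖ ≤ N * ‖e x‖ := fun x => by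
    calc ‖x‖ = ‖(e.symm : H' →L[ℂ] H) (e x)‖ := by simp
      _ ≤ ‖(e.symm : H' →L[ℂ] H)‖ * ‖e x‖ := ContinuousLinearMap.le_opNorm _ _
      _ ≤ N * ‖e x‖ := mul_le_mul_of_nonneg_right (by linarith) (norm_nonneg _)
  refine ⟨?_, A / N ^ 2, max (A / N ^ 2) (B * M ^ 2), by positivity, le_max_left _ _,
    fun c hc => ?_⟩
  · have hr : Set.range (fun n => e (v n)) = (e : H →L[ℂ] H') '' Set.range v := by
      rw [← Set.range_comp]; rfl
    rw [hr]
    have := DenseRange.topologicalClosure_map_submodule (f := (e : H →L[ℂ] H'))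
      e.surjective.denseRange hd
    rw [Submodule.map_span] at this
    exact this
  · obtain ⟨h1, h2, h3⟩ := h c hc
    have hs := (e : H →L[ℂ] H').hasSum h1.hasSum
    simp only [ContinuousLinearMap.map_smul, ContinuousLinearEquiv.coe_coe] at hs
    refine ⟨hs.summable, ?_⟩
    rw [hs.tsum_eq]
    set y := ∑' n, c n • v n
    have hc0 : 0 ≤ ∑' n, ‖c n‖ ^ 2 := tsum_nonneg fun n => by positivity
    constructor
    · rw [div_mul_eq_mul_div, div_le_iff₀ (by positivity)]
      have := pow_le_pow_left₀ (norm_nonneg _) (hxe y) 2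
      calc A * ∑' n, ‖c n‖ ^ 2 ≤ ‖y‖ ^ 2 := h2
        _ ≤ (N * ‖e y‖) ^ 2 := this
        _ = _ := by ring
    · have := pow_le_pow_left₀ (norm_nonneg _) (hex y) 2
      calc ‖e y‖ ^ 2 ≤ (M * ‖y‖) ^ 2 := this
        _ = M ^ 2 * ‖y‖ ^ 2 := by ring
        _ ≤ M ^ 2 * (B * ∑' n, ‖c n‖ ^ 2) := by gcongr
        _ = B * M ^ 2 * ∑' n, ‖c n‖ ^ 2 := by ring
        _ ≤ _ := by gcongr; exact le_max_right _ _

/-- The synthesis operator of `v` is bounded on `ℓ²` with bound `B`. -/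
def IsBessel (v : ℤ → H) (B : ℝ) : Prop :=
  ∀ c : ℤ → ℂ, Summable (fun n => ‖c n‖ ^ 2) →
    Summable (fun n => c n • v n) ∧ ‖∑' n, c n • v n‖ ^ 2 ≤ B * ∑' n, ‖c n‖ ^ 2

lemma IsRieszBasis.exists_isBessel {v : ℤ → H} (hv : IsRieszBasis v) :
    ∃ B, 0 < B ∧ IsBessel v B := by
  obtain ⟨-, A, B, hA, hAB, h⟩ := hv
  exact ⟨B, hA.trans_le hAB, fun c hc => ⟨(h c hc).1, (h c hc).2.2⟩⟩

/-- Duality: for a finite sum `y = ∑ c n • v n`, expanding `⟪y, y⟫` and applying Cauchy–Schwarz and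
the upper frame bound gives `‖y‖⁴ ≤ ‖c‖² B ‖y‖²`. Cancelling `‖y‖²` leaves a bound that also gives
the Cauchy criterion for infinite sums. -/
lemma IsFrame.exists_isBessel [CompleteSpace H] {v : ℤ → H} (hv : IsFrame v) :
    ∃ B, 0 < B ∧ IsBessel v B := by
  obtain ⟨A, B, hA, hAB, h⟩ := hv
  have hB : 0 < B := hA.trans_le hAB
  have key : ∀ (c : ℤ → ℂ) (s : Finset ℤ),
      ‖∑ n ∈ s, c n • v n‖ ^ 2 ≤ B * ∑ n ∈ s, ‖c n‖ ^ 2 := by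
    intro c s
    set y := ∑ n ∈ s, c n • v n with hy
    obtain ⟨h1, -, h3⟩ := h y
    have e1 : ‖y‖ ^ 2 ≤ ∑ n ∈ s, ‖c n‖ * ‖inner ℂ y (v n)‖ := by
      have : (inner ℂ y y : ℂ) = ∑ n ∈ s, c n * inner ℂ y (v n) := by
        conv_lhs => rw [hy, inner_sum]
        simp_rw [inner_smul_right, ← hy]
      have h' : ‖y‖ ^ 2 = ‖(inner ℂ y y : ℂ)‖ := by
        rw [inner_self_eq_norm_sq_to_K]; simp
      rw [h', this]
      refine (norm_sum_le _ _).trans (le_of_eq ?_)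
      simp
    have e2 : (∑ n ∈ s, ‖c n‖ * ‖inner ℂ y (v n)‖) ^ 2
        ≤ (∑ n ∈ s, ‖c n‖ ^ 2) * ∑ n ∈ s, ‖inner ℂ y (v n)‖ ^ 2 :=
      Finset.sum_mul_sq_le_sq_mul_sq _ _ _
    have e3 : ∑ n ∈ s, ‖inner ℂ y (v n)‖ ^ 2 ≤ B * ‖y‖ ^ 2 :=
      (h1.sum_le_tsum s fun n _ => by positivity).trans h3
    have hc0 : 0 ≤ ∑ n ∈ s, ‖c n‖ ^ 2 := Finset.sum_nonneg fun n _ => by positivity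
    rcases eq_or_lt_of_le (sq_nonneg ‖y‖) with h0 | h0
    · rw [← h0]; positivity
    · have e4 : (‖y‖ ^ 2) ^ 2 ≤ (∑ n ∈ s, ‖c n‖ ^ 2) * (B * ‖y‖ ^ 2) :=
        (pow_le_pow_left₀ h0.le e1 2).trans (e2.trans (mul_le_mul_of_nonneg_left e3 hc0))
      refine le_of_mul_le_mul_right ?_ h0
      calc ‖y‖ ^ 2 * ‖y‖ ^ 2 = (‖y‖ ^ 2) ^ 2 := by ring
        _ ≤ _ := e4
        _ = _ := by ring
  refine ⟨B, hB, fun c hc => ?_⟩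
  have hs : Summable (fun n => c n • v n) := by
    rw [summable_iff_vanishing_norm]
    intro ε hε
    rw [summable_iff_vanishing_norm] at hc
    obtain ⟨s, hs⟩ := hc (ε ^ 2 / B) (by positivity)
    refine ⟨s, fun t ht => ?_⟩
    have h1 := hs t ht
    rw [Real.norm_of_nonneg (Finset.sum_nonneg fun n _ => by positivity), lt_div_iff₀ hB] at h1
    refine lt_of_pow_lt_pow_left₀ 2 hε.le ?_
    calc _ ≤ _ := key c t
      _ < _ := by linarith
  refine ⟨hs, ?_⟩
  refine le_of_tendsto ((hs.hasSum.norm).pow 2) (Eventually.of_forall fun s => ?_)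
  refine (key c s).trans (mul_le_mul_of_nonneg_left ?_ hB.le)
  exact hc.sum_le_tsum s fun n _ => by positivity

lemma HilbertBasis.hasSum_norm_inner_sq {ι : Type*} (e : HilbertBasis ι ℂ H) (x : H) :
    HasSum (fun n => ‖inner ℂ x (e n)‖ ^ 2) (‖x‖ ^ 2) := by
  have h := e.hasSum_inner_mul_inner x x
  rw [inner_self_eq_norm_sq_to_K] at h
  have h' := Complex.hasSum_re h
  convert h' using 1
  · ext n
    rw [← inner_conj_symm (e n) x, Complex.mul_conj, Complex.normSq_eq_norm_sq]
    rfl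
  · simp [← Complex.ofReal_pow]

lemma HilbertBasis.exists_hasSum_smul {ι : Type*} (e : HilbertBasis ι ℂ H) {d : ι → ℂ}
    (hd : Summable fun n => ‖d n‖ ^ 2) :
    ∃ x, HasSum (fun n => d n • e n) x ∧ (∀ n, inner ℂ (e n) x = d n) ∧
      ‖x‖ ^ 2 = ∑' n, ‖d n‖ ^ 2 := by
  have hm : Memℓp d 2 := by
    rw [memℓp_gen_iff (by norm_num)]
    simpa using hd
  let f : lp (fun _ : ι => ℂ) 2 := ⟨d, hm⟩
  have hi : ∀ n, inner ℂ (e n) (e.repr.symm f) = d n := fun n => by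
    rw [← e.repr_apply_apply]; simp [f]
  refine ⟨e.repr.symm f, e.hasSum_repr_symm f, hi, ?_⟩
  rw [← (HilbertBasis.hasSum_norm_inner_sq e (e.repr.symm f)).tsum_eq]
  congr 1; ext n
  rw [norm_inner_symm, hi]

lemma HilbertBasis.isFrame_smul (e : HilbertBasis ℤ ℂ H) {u : ℤ → ℂ} {r : ℝ} (hr : 0 < r)
    (hu : ∀ n, ‖u n‖ = r) : IsFrame (fun n => u n • e n) := by
  refine ⟨r ^ 2, r ^ 2, by positivity, le_rfl, fun x => ?_⟩
  have h := (HilbertBasis.hasSum_norm_inner_sq e x).mul_left (r ^ 2)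
  have h' : HasSum (fun n => ‖inner ℂ x (u n • e n)‖ ^ 2) (r ^ 2 * ‖x‖ ^ 2) := by
    have hn : ∀ n, ‖inner ℂ x (u n • e n)‖ ^ 2 = r ^ 2 * ‖inner ℂ x (e n)‖ ^ 2 := fun n => by
      rw [inner_smul_right, norm_mul, hu, mul_pow]
    simpa only [hn] using h
  exact ⟨h'.summable, h'.tsum_eq.ge, h'.tsum_eq.le⟩

lemma HilbertBasis.isRieszBasis_smul (e : HilbertBasis ℤ ℂ H) {u : ℤ → ℂ} {r : ℝ} (hr : 0 < r)
    (hu : ∀ n, ‖u n‖ = r) : IsRieszBasis (fun n => u n • e n) := by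
  have hu0 : ∀ n, u n ≠ 0 := fun n h => by have := hu n; simp [h] at this; linarith
  refine ⟨?_, r ^ 2, r ^ 2, by positivity, le_rfl, fun c hc => ?_⟩
  · have : Submodule.span ℂ (Set.range fun n => u n • e n) = Submodule.span ℂ (Set.range e) := by
      refine le_antisymm (Submodule.span_le.2 ?_) (Submodule.span_le.2 ?_)
      · rintro _ ⟨n, rfl⟩
        exact Submodule.smul_mem _ _ (Submodule.subset_span ⟨n, rfl⟩)
      · rintro _ ⟨n, rfl⟩
        have : e n = (u n)⁻¹ • (u n • e n) := by rw [smul_smul, inv_mul_cancel₀ (hu0 n), one_smul]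
        rw [this]
        exact Submodule.smul_mem _ _ (Submodule.subset_span ⟨n, rfl⟩)
    rw [this, e.dense_span]
  · have hn : ∀ n, ‖c n * u n‖ ^ 2 = r ^ 2 * ‖c n‖ ^ 2 := fun n => by
      rw [norm_mul, hu, mul_pow, mul_comm]
    obtain ⟨x, hx, -, hx'⟩ := HilbertBasis.exists_hasSum_smul e (d := fun n => c n * u n)
      (by simp_rw [hn]; exact hc.mul_left _)
    simp_rw [hn, tsum_mul_left] at hx'
    simp_rw [smul_smul]
    refine ⟨hx.summable, ?_⟩
    rw [hx.tsum_eq, hx']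
    exact ⟨le_rfl, le_rfl⟩

end Frames

/-! ### Multiplication operators on `L²` -/

section Multiplication

variable {α : Type*} [MeasurableSpace α] {μ : Measure α}

lemma enorm_sq_eq_lintegral (f : Lp ℂ 2 μ) : ‖f‖ₑ ^ 2 = ∫⁻ x, ‖f x‖ₑ ^ 2 ∂μ := by
  have h := eLpNorm_nnreal_pow_eq_lintegral (μ := μ) (f := f) (p := 2) (by norm_num)
  rw [Lp.enorm_def]
  simpa using h

lemma ofReal_mul_norm_sq {E : Type*} [NormedAddCommGroup E] {A : ℝ} (hA : 0 ≤ A) (f : E) :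
    ENNReal.ofReal (A * ‖f‖ ^ 2) = ENNReal.ofReal A * ‖f‖ₑ ^ 2 := by
  rw [ENNReal.ofReal_mul hA, ENNReal.ofReal_pow (norm_nonneg _), ofReal_norm]

/-- Multiplication by an essentially bounded function. -/
def mulL {m : α → ℂ} (hm : MemLp m ∞ μ) : Lp ℂ 2 μ →L[ℂ] Lp ℂ 2 μ :=
  (ContinuousLinearMap.mul ℂ ℂ).holderL μ ∞ 2 2 (hm.toLp m)

lemma coeFn_mulL {m : α → ℂ} (hm : MemLp m ∞ μ) (f : Lp ℂ 2 μ) :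
    mulL hm f =ᵐ[μ] fun x => m x * f x := by
  have h := ContinuousLinearMap.coeFn_holder (r := 2) (ContinuousLinearMap.mul ℂ ℂ)
    (hm.toLp m) f
  filter_upwards [h, hm.coeFn_toLp] with x h1 h2
  change ((ContinuousLinearMap.mul ℂ ℂ).holder 2 (hm.toLp m) f) x = _
  rw [h1, h2]; rfl

lemma mulL_eq {m : α → ℂ} (hm : MemLp m ∞ μ) {f g : Lp ℂ 2 μ}
    (h : g =ᵐ[μ] fun x => m x * f x) : mulL hm f = g :=
  Lp.ext ((coeFn_mulL hm f).trans h.symm)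

/-- Multiplication by a function that is bounded together with its inverse. -/
def mulEquiv {m m' : α → ℂ} (hm : MemLp m ∞ μ) (hm' : MemLp m' ∞ μ)
    (h : ∀ᵐ x ∂μ, m x * m' x = 1) : Lp ℂ 2 μ ≃L[ℂ] Lp ℂ 2 μ :=
  ContinuousLinearEquiv.equivOfInverse (mulL hm) (mulL hm')
    (fun f => mulL_eq _ (by
      filter_upwards [coeFn_mulL hm f, h] with x h1 h2
      rw [h1, ← mul_assoc, mul_comm (m' x), h2, one_mul]))
    (fun f => mulL_eq _ (by
      filter_upwards [coeFn_mulL hm' f, h] with x h1 h2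
      rw [h1, ← mul_assoc, h2, one_mul]))

lemma inner_mulL_right {m : α → ℂ} (hm : MemLp m ∞ μ) (hm' : MemLp (fun x => conj (m x)) ∞ μ)
    (f g : Lp ℂ 2 μ) : inner ℂ f (mulL hm g) = inner ℂ (mulL hm' f) g := by
  rw [L2.inner_def, L2.inner_def]
  refine integral_congr_ae ?_
  filter_upwards [coeFn_mulL hm g, coeFn_mulL hm' f] with x h1 h2
  rw [h1, h2]
  simp only [RCLike.inner_apply, map_mul, RingHomCompTriple.comp_apply, RingHom.id_apply]
  ring

/-- An essential lower bound for `f` follows from a lower bound for the multiplication by `f`. -/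
lemma ae_le_norm_sq_of_forall_le_norm [IsFiniteMeasure μ] {f : α → ℂ} (hf : MemLp f 2 μ) {A : ℝ}
    (hA : 0 ≤ A)
    (h : ∀ D y : Lp ℂ 2 μ, (y =ᵐ[μ] fun x => D x * f x) → A * ‖D‖ ^ 2 ≤ ‖y‖ ^ 2) :
    ∀ᵐ x ∂μ, A ≤ ‖f x‖ ^ 2 := by
  have key : (fun _ => ENNReal.ofReal A) ≤ᵐ[μ] fun x => ‖f x‖ₑ ^ 2 := by
    refine ae_le_of_forall_setLIntegral_le_of_sigmaFinite₀ aemeasurable_const fun s hs _ => ?_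
    -- Testing the hypothesis on the indicator of `s` gives `A μ(s) ≤ ∫ₛ |f|²`.
    have hD : MemLp (s.indicator fun _ => (1 : ℂ)) 2 μ := (memLp_const 1).indicator hs
    have hy : MemLp (s.indicator f) 2 μ := hf.indicator hs
    have h1 := h (hD.toLp _) (hy.toLp _) (by
      filter_upwards [hD.coeFn_toLp, hy.coeFn_toLp] with x h1 h2
      rw [h1, h2]
      by_cases hx : x ∈ s <;> simp [hx])
    have h2 := ENNReal.ofReal_le_ofReal h1
    rw [← one_mul (‖hy.toLp _‖ ^ 2), ofReal_mul_norm_sq hA, ofReal_mul_norm_sq zero_le_one,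
      enorm_sq_eq_lintegral, enorm_sq_eq_lintegral, ENNReal.ofReal_one, one_mul] at h2
    have e1 : ∫⁻ x, ‖hD.toLp _ x‖ₑ ^ 2 ∂μ = μ s := by
      rw [← lintegral_indicator_one hs]
      refine lintegral_congr_ae ?_
      filter_upwards [hD.coeFn_toLp] with x h1
      rw [h1]
      by_cases hx : x ∈ s <;> simp [hx]
    have e2 : ∫⁻ x, ‖hy.toLp _ x‖ₑ ^ 2 ∂μ = ∫⁻ x in s, ‖f x‖ₑ ^ 2 ∂μ := by
      rw [← lintegral_indicator hs]
      refine lintegral_congr_ae ?_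
      filter_upwards [hy.coeFn_toLp] with x h1
      rw [h1]
      by_cases hx : x ∈ s <;> simp [hx]
    rw [e1, e2] at h2
    simpa using h2
  filter_upwards [key] with x hx
  have h3 : ENNReal.ofReal A ≤ ENNReal.ofReal (‖f x‖ ^ 2) := by
    rwa [ENNReal.ofReal_pow (norm_nonneg _), ofReal_norm]
  exact (ENNReal.ofReal_le_ofReal_iff (by positivity)).1 h3

lemma memLp_inv_of_le_norm {P : α → ℂ} (hm : AEStronglyMeasurable P μ) {a₀ : ℝ} (ha : 0 < a₀)
    (hP : ∀ᵐ x ∂μ, a₀ ≤ ‖P x‖) : MemLp (fun x => (P x)⁻¹) ∞ μ := by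
  refine memLp_top_of_bound ?_ a₀⁻¹ ?_
  · exact hm.aemeasurable.inv.aestronglyMeasurable
  · filter_upwards [hP] with x hx
    rw [norm_inv]
    exact inv_anti₀ ha hx

end Multiplication

/-! ### Sampling in `L²` with a multiplier -/

section Sampling

variable {α X : Type*} [MeasurableSpace α] {μ : Measure α}

/-- The values of `D` at the points `t` are `⟪k t, D⟫`; the samples at the points `p n` are the
coefficients of `D P` in the basis `e` up to the factors `w n`. -/
structure SamplingSystem (e : HilbertBasis ℤ ℂ (Lp ℂ 2 μ)) (P : α → ℂ) (k : X → Lp ℂ 2 μ)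
    (p : ℤ → X) (w : ℤ → ℂ) (r : ℝ) : Prop where
  memLp : MemLp P 2 μ
  pos : 0 < r
  norm_eq : ∀ n, ‖w n‖ = r
  ext : ∀ D : Lp ℂ 2 μ, (∀ t, inner ℂ (k t) D = 0) → D = 0
  sample : ∀ n (D y : Lp ℂ 2 μ), (y =ᵐ[μ] fun x => D x * P x) →
    inner ℂ (k (p n)) D = w n * inner ℂ (e n) y

/-- The sampling expansion with respect to `s`. -/
def IsExpansion (k : X → Lp ℂ 2 μ) (p : ℤ → X) (s : ℤ → Lp ℂ 2 μ) : Prop :=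
  ∀ D t, HasSum (fun n => inner ℂ (k (p n)) D * inner ℂ (k t) (s n)) (inner ℂ (k t) D)

variable {e : HilbertBasis ℤ ℂ (Lp ℂ 2 μ)} {P : α → ℂ} {k : X → Lp ℂ 2 μ}
  {p : ℤ → X} {w : ℤ → ℂ} {r : ℝ}

namespace SamplingSystem

lemma w_ne_zero (h : SamplingSystem e P k p w r) (n : ℤ) : w n ≠ 0 := by
  intro h0
  have h1 := h.norm_eq n
  rw [h0, norm_zero] at h1
  exact h.pos.ne h1

lemma hasSum_norm_sample_sq (h : SamplingSystem e P k p w r) {D y : Lp ℂ 2 μ}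
    (hy : y =ᵐ[μ] fun x => D x * P x) :
    HasSum (fun n => ‖(inner ℂ (k (p n)) D : ℂ)‖ ^ 2) (r ^ 2 * ‖y‖ ^ 2) := by
  have h1 := (HilbertBasis.hasSum_norm_inner_sq e y).mul_left (r ^ 2)
  have hn : ∀ n, ‖(inner ℂ (k (p n)) D : ℂ)‖ ^ 2 = r ^ 2 * ‖(inner ℂ y (e n) : ℂ)‖ ^ 2 := by
    intro n
    rw [h.sample n D y hy, norm_mul, mul_pow, h.norm_eq, norm_inner_symm]
  simpa only [hn] using h1

/-- The expansion rebuilds `D` from its samples, whose square sum is `r² ‖D P‖²`. The Bessel bound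
therefore gives `‖D‖² ≤ B r² ‖D P‖²` whenever `D P` is in `L²`, which is a pointwise lower bound for
`|P|`. -/
lemma exists_le_norm_of_isBessel [IsFiniteMeasure μ]
    (h : SamplingSystem e P k p w r) {s : ℤ → Lp ℂ 2 μ}
    (hs : IsExpansion k p s) {B : ℝ} (hB : 0 < B) (hb : IsBessel s B) :
    ∃ a₀ : ℝ, 0 < a₀ ∧ ∀ᵐ x ∂μ, a₀ ≤ ‖P x‖ := by
  have hr := h.pos
  have key : ∀ᵐ x ∂μ, (B * r ^ 2)⁻¹ ≤ ‖P x‖ ^ 2 := by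
    refine ae_le_norm_sq_of_forall_le_norm h.memLp (by positivity) fun D y hy => ?_
    have h1 := h.hasSum_norm_sample_sq hy
    obtain ⟨h2, h3⟩ := hb _ h1.summable
    -- The expansion is only pointwise. The Bessel property gives convergence in `L²`, and a
    -- function is determined by its values.
    have h4 : ∑' n, (inner ℂ (k (p n)) D : ℂ) • s n = D := by
      rw [← sub_eq_zero]
      refine h.ext _ fun t => ?_
      have h5 := (innerSL ℂ (k t)).hasSum h2.hasSum
      simp only [innerSL_apply_apply, inner_smul_right] at h5
      rw [inner_sub_right, sub_eq_zero]
      exact h5.unique (hs D t)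
    rw [h4, h1.tsum_eq] at h3
    rw [inv_mul_le_iff₀ (by positivity)]
    linarith
  refine ⟨√((B * r ^ 2)⁻¹), by positivity, ?_⟩
  filter_upwards [key] with x hx
  exact Real.sqrt_le_iff.2 ⟨norm_nonneg _, hx⟩

/-! ### Interpolating functions when `|P|` is bounded below -/

section LowerBound

variable {a₀ : ℝ}

lemma memLp_inv (h : SamplingSystem e P k p w r) (ha : 0 < a₀) (hP : ∀ᵐ x ∂μ, a₀ ≤ ‖P x‖) :
    MemLp (fun x => (P x)⁻¹) ∞ μ := memLp_inv_of_le_norm h.memLp.1 ha hP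

/-- The interpolating functions. -/
def dual (h : SamplingSystem e P k p w r) (ha : 0 < a₀) (hP : ∀ᵐ x ∂μ, a₀ ≤ ‖P x‖) (n : ℤ) :
    Lp ℂ 2 μ := mulL (h.memLp_inv ha hP) ((w n)⁻¹ • e n)

lemma dual_mul (h : SamplingSystem e P k p w r) (ha : 0 < a₀) (hP : ∀ᵐ x ∂μ, a₀ ≤ ‖P x‖)
    (n : ℤ) : ((w n)⁻¹ • e n : Lp ℂ 2 μ) =ᵐ[μ] fun x => h.dual ha hP n x * P x := by
  filter_upwards [coeFn_mulL (h.memLp_inv ha hP) ((w n)⁻¹ • e n), hP] with x h1 h2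
  have : P x ≠ 0 := fun h0 => by rw [h0, norm_zero] at h2; linarith
  rw [dual, h1]
  field_simp

lemma sample_dual (h : SamplingSystem e P k p w r) (ha : 0 < a₀) (hP : ∀ᵐ x ∂μ, a₀ ≤ ‖P x‖)
    (n m : ℤ) : inner ℂ (k (p m)) (h.dual ha hP n) = if n = m then 1 else 0 := by
  rw [h.sample m _ _ (h.dual_mul ha hP n), inner_smul_right]
  rw [orthonormal_iff_ite.1 e.orthonormal m n]
  have := h.w_ne_zero m
  by_cases hnm : n = m
  · simp [hnm, this]
  · simp [hnm, Ne.symm hnm]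

/-- Expanding the `n`-th interpolating function along `s` leaves the single term `s n`, since its
samples are Kronecker deltas. No upper bound for `|P|` is needed. -/
lemma eq_dual_of_isExpansion (h : SamplingSystem e P k p w r) (ha : 0 < a₀)
    (hP : ∀ᵐ x ∂μ, a₀ ≤ ‖P x‖) {s : ℤ → Lp ℂ 2 μ} (hs : IsExpansion k p s) :
    s = h.dual ha hP := by
  ext1 n
  rw [← sub_eq_zero]
  refine h.ext _ fun t => ?_
  rw [inner_sub_right, sub_eq_zero]
  have h1 := hs (h.dual ha hP n) t
  simp only [h.sample_dual ha hP] at h1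
  have h2 := hasSum_single (f := fun m => (if n = m then (1 : ℂ) else 0) * inner ℂ (k t) (s m)) n
    (fun m hm => by simp [Ne.symm hm])
  simpa using h2.unique h1

/-- The upper bound puts `D P` in `L²`; its expansion in the basis `e`, divided by `P`, is the
asserted series. -/
lemma hasSum_sample_smul_dual (h : SamplingSystem e P k p w r) (ha : 0 < a₀)
    (hP : ∀ᵐ x ∂μ, a₀ ≤ ‖P x‖) {b₀ : ℝ} (hP' : ∀ᵐ x ∂μ, ‖P x‖ ≤ b₀) (D : Lp ℂ 2 μ) :
    HasSum (fun n => (inner ℂ (k (p n)) D : ℂ) • h.dual ha hP n) D := by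
  have hm : MemLp P ∞ μ := memLp_top_of_bound h.memLp.1 b₀ hP'
  have hy : mulL hm D =ᵐ[μ] fun x => D x * P x := by
    filter_upwards [coeFn_mulL hm D] with x hx
    rw [hx, mul_comm]
  have h1 := (mulL (h.memLp_inv ha hP)).hasSum (e.hasSum_repr (mulL hm D))
  have h2 : mulL (h.memLp_inv ha hP) (mulL hm D) = D := mulL_eq _ (by
    filter_upwards [coeFn_mulL hm D, hP] with x h1 h2
    have : P x ≠ 0 := fun h0 => by rw [h0, norm_zero] at h2; linarith
    rw [h1]
    field_simp)
  rw [h2] at h1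
  convert h1 using 2 with n
  have := h.w_ne_zero n
  rw [h.sample n D _ hy, dual, map_smul, map_smul, smul_smul, e.repr_apply_apply]
  congr 1
  field_simp

/-- The multiplication by `1 / P`, as an isomorphism. -/
def invEquiv (h : SamplingSystem e P k p w r) (ha : 0 < a₀)
    (hP : ∀ᵐ x ∂μ, a₀ ≤ ‖P x‖) {b₀ : ℝ} (hP' : ∀ᵐ x ∂μ, ‖P x‖ ≤ b₀) :
    Lp ℂ 2 μ ≃L[ℂ] Lp ℂ 2 μ :=
  mulEquiv (h.memLp_inv ha hP) (memLp_top_of_bound h.memLp.1 b₀ hP') (by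
    filter_upwards [hP] with x hx
    have : P x ≠ 0 := fun h0 => by rw [h0, norm_zero] at hx; linarith
    field_simp)

lemma isFrame_dual (h : SamplingSystem e P k p w r) (ha : 0 < a₀)
    (hP : ∀ᵐ x ∂μ, a₀ ≤ ‖P x‖) {b₀ : ℝ} (hP' : ∀ᵐ x ∂μ, ‖P x‖ ≤ b₀) :
    IsFrame (h.dual ha hP) :=
  (HilbertBasis.isFrame_smul e (u := fun n => (w n)⁻¹) (inv_pos.2 h.pos)
    (fun n => by rw [norm_inv, h.norm_eq])).map (h.invEquiv ha hP hP')

lemma isRieszBasis_dual (h : SamplingSystem e P k p w r) (ha : 0 < a₀)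
    (hP : ∀ᵐ x ∂μ, a₀ ≤ ‖P x‖) {b₀ : ℝ} (hP' : ∀ᵐ x ∂μ, ‖P x‖ ≤ b₀) :
    IsRieszBasis (h.dual ha hP) :=
  (HilbertBasis.isRieszBasis_smul e (u := fun n => (w n)⁻¹) (inv_pos.2 h.pos)
    (fun n => by rw [norm_inv, h.norm_eq])).map (h.invEquiv ha hP hP')

lemma exists_norm_le_of_ae (ha : 0 < a₀) (hP : ∀ᵐ x ∂μ, a₀ ≤ ‖P x‖) {A : ℝ} (hA : 0 < A)
    (hA' : ∀ᵐ x ∂μ, A ≤ ‖(P x)⁻¹‖ ^ 2) : ∃ b₀ : ℝ, ∀ᵐ x ∂μ, ‖P x‖ ≤ b₀ := by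
  refine ⟨√(A⁻¹), ?_⟩
  filter_upwards [hP, hA'] with x h1 h2
  have h3 : 0 < ‖P x‖ := ha.trans_le h1
  refine Real.le_sqrt_of_sq_le ?_
  rw [norm_inv, inv_pow] at h2
  exact (le_inv_comm₀ hA (by positivity)).1 h2

/-- Moving `1 / P` to the other side of the inner product turns the lower frame bound into `A r²
‖D‖² ≤ ‖D / P‖²`, a pointwise lower bound for `|1 / P|`. -/
lemma exists_norm_le_of_isFrame [IsFiniteMeasure μ]
    (h : SamplingSystem e P k p w r) (ha : 0 < a₀)
    (hP : ∀ᵐ x ∂μ, a₀ ≤ ‖P x‖) (hf : IsFrame (h.dual ha hP)) :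
    ∃ b₀ : ℝ, ∀ᵐ x ∂μ, ‖P x‖ ≤ b₀ := by
  obtain ⟨A, B, hA, hAB, hf⟩ := hf
  have hr := h.pos
  have hm := h.memLp_inv ha hP
  have hm' : MemLp (fun x => conj ((P x)⁻¹)) ∞ μ := hm.star
  refine exists_norm_le_of_ae (A := A * r ^ 2) ha hP (by positivity) ?_
  refine ae_le_norm_sq_of_forall_le_norm (hm.mono_exponent le_top) (by positivity)
    fun D y hy => ?_
  obtain ⟨-, h2, -⟩ := hf D
  have hn : ∀ n, ‖(inner ℂ D (h.dual ha hP n) : ℂ)‖ ^ 2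
      = (r ^ 2)⁻¹ * ‖(inner ℂ (mulL hm' D) (e n) : ℂ)‖ ^ 2 := fun n => by
    rw [dual, inner_mulL_right hm hm', inner_smul_right, norm_mul, norm_inv, h.norm_eq, mul_pow,
      inv_pow]
  simp_rw [hn, tsum_mul_left, (HilbertBasis.hasSum_norm_inner_sq e (mulL hm' D)).tsum_eq] at h2
  -- The adjoint multiplies by the conjugate of `1 / P`, which has the same modulus.
  have hy' : ‖mulL hm' D‖ = ‖y‖ := by
    refine le_antisymm (Lp.norm_le_norm_of_ae_le ?_) (Lp.norm_le_norm_of_ae_le ?_) <;>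
    · filter_upwards [hy, coeFn_mulL hm' D] with x h1 h2
      rw [h1, h2]
      simp [mul_comm]
  rw [hy', le_inv_mul_iff₀ (by positivity)] at h2
  linarith

/-- With coefficients `w n * ⟪e n, D⟫` the series sums to `D / P` while the coefficients have square
sum `r² ‖D‖²`, so the lower Riesz bound gives the same inequality as for frames. -/
lemma exists_norm_le_of_isRieszBasis [IsFiniteMeasure μ]
    (h : SamplingSystem e P k p w r) (ha : 0 < a₀)
    (hP : ∀ᵐ x ∂μ, a₀ ≤ ‖P x‖) (hf : IsRieszBasis (h.dual ha hP)) :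
    ∃ b₀ : ℝ, ∀ᵐ x ∂μ, ‖P x‖ ≤ b₀ := by
  obtain ⟨-, A, B, hA, hAB, hf⟩ := hf
  have hr := h.pos
  have hm := h.memLp_inv ha hP
  refine exists_norm_le_of_ae (A := A * r ^ 2) ha hP (by positivity) ?_
  refine ae_le_norm_sq_of_forall_le_norm (hm.mono_exponent le_top) (by positivity)
    fun D y hy => ?_
  have hn : ∀ n, ‖w n * (inner ℂ (e n) D : ℂ)‖ ^ 2
      = r ^ 2 * ‖(inner ℂ D (e n) : ℂ)‖ ^ 2 := fun n => by
    rw [norm_mul, h.norm_eq, mul_pow, norm_inner_symm]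
  have hD := (HilbertBasis.hasSum_norm_inner_sq e D).mul_left (r ^ 2)
  obtain ⟨-, h2, -⟩ := hf (fun n => w n * (inner ℂ (e n) D : ℂ)) (by
    simp_rw [hn]; exact hD.summable)
  have h3 : HasSum (fun n => (w n * (inner ℂ (e n) D : ℂ)) • h.dual ha hP n) y := by
    have h4 := (mulL hm).hasSum (e.hasSum_repr D)
    rw [mulL_eq hm (hy.trans (Eventually.of_forall fun x => mul_comm _ _))] at h4
    convert h4 using 2 with n
    have := h.w_ne_zero n
    rw [dual, map_smul, map_smul, smul_smul, e.repr_apply_apply]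
    congr 1
    field_simp
  simp_rw [hn, hD.tsum_eq, h3.tsum_eq] at h2
  linarith

end LowerBound

end SamplingSystem

end Sampling

/-! ### Periodization -/

section Periodization

lemma haarAddCircle_eq_volume :
    (AddCircle.haarAddCircle : Measure UnitAddCircle) = volume := by
  have h := AddCircle.volume_eq_smul_haarAddCircle (T := (1 : ℝ))
  rw [ENNReal.ofReal_one, one_smul] at h
  exact h.symm

lemma measurePreserving_coe_Ioc (t : ℝ) :
    MeasurePreserving (fun w : ℝ => (w : UnitAddCircle)) (volume.restrict (Set.Ioc t (t + 1)))
      AddCircle.haarAddCircle := by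
  rw [haarAddCircle_eq_volume]
  exact UnitAddCircle.measurePreserving_mk t

lemma ae_of_ae_restrict_of_periodic {p : ℝ → Prop} {L : ℝ} (hL : 0 < L)
    (hp : ∀ ξ, p (ξ + L) ↔ p ξ) (h : ∀ᵐ ξ ∂(volume.restrict (Set.Icc 0 L)), p ξ) :
    ∀ᵐ ξ : ℝ, p ξ := by
  rw [ae_restrict_iff' measurableSet_Icc] at h
  have h1 : ∀ n : ℤ, ∀ᵐ ξ : ℝ, ξ - n * L ∈ Set.Icc 0 L → p (ξ - n * L) := fun n =>
    (measurePreserving_sub_right volume (n * L)).quasiMeasurePreserving.ae h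
  have hp' : ∀ (n : ℤ) ξ, p (ξ - n * L) ↔ p ξ := by
    intro n
    induction n using Int.induction_on with
    | zero => simp
    | succ n ih =>
      intro ξ
      rw [← ih ξ, ← hp (ξ - ((n : ℤ) + 1 : ℤ) * L)]
      push_cast
      ring_nf
    | pred n ih =>
      intro ξ
      rw [← ih ξ, ← hp (ξ - (-(n : ℤ) : ℤ) * L)]
      push_cast
      ring_nf
  filter_upwards [ae_all_iff.2 h1] with ξ hξ
  -- Subtracting `⌊ξ / L⌋` periods moves `ξ` into `[0, L]`.
  rw [← hp' ⌊ξ / L⌋ ξ]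
  refine hξ _ ⟨?_, ?_⟩
  · have := Int.floor_le (ξ / L)
    rw [le_div_iff₀ hL] at this
    linarith
  · have := (Int.lt_floor_add_one (ξ / L)).le
    rw [div_le_iff₀ hL] at this
    linarith

lemma ae_comp_mul_iff {κ : ℝ} (hκ : κ ≠ 0) {p : ℝ → Prop} :
    (∀ᵐ ξ : ℝ, p (κ * ξ)) ↔ ∀ᵐ w : ℝ, p w := by
  constructor
  · intro h
    have := (Measure.quasiMeasurePreserving_smul (volume : Measure ℝ) (inv_ne_zero hκ)).ae h
    filter_upwards [this] with w hw
    simpa [mul_inv_cancel_left₀ hκ] using hw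
  · intro h
    exact (Measure.quasiMeasurePreserving_smul (volume : Measure ℝ) hκ).ae h

lemma ae_coe_of_ae_haarAddCircle {p : UnitAddCircle → Prop}
    (h : ∀ᵐ x ∂AddCircle.haarAddCircle, p x) : ∀ᵐ w : ℝ, p (w : UnitAddCircle) := by
  refine ae_of_ae_restrict_of_periodic (L := 1) one_pos (fun ξ => by
    rw [AddCircle.coe_add_period]) ?_
  have := (measurePreserving_coe_Ioc 0).quasiMeasurePreserving.ae h
  rwa [zero_add, ← Measure.restrict_congr_set Ioc_ae_eq_Icc.symm] at this

lemma ae_haarAddCircle_of_ae_coe {p : UnitAddCircle → Prop} (hp : MeasurableSet {x | p x})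
    (h : ∀ᵐ w : ℝ, p (w : UnitAddCircle)) : ∀ᵐ x ∂AddCircle.haarAddCircle, p x := by
  have hm := measurePreserving_coe_Ioc 0
  rw [← hm.map_eq, ae_map_iff hm.measurable.aemeasurable hp]
  exact ae_restrict_of_ae h

/-- The projection of the line scaled by `κ` to the circle. -/
def circleMap (κ ξ : ℝ) : UnitAddCircle := ((κ * ξ : ℝ) : UnitAddCircle)

lemma measurable_circleMap (κ : ℝ) : Measurable (circleMap κ) :=
  (AddCircle.continuous_mk' (1 : ℝ)).measurable.comp (measurable_const_mul κ)

lemma ae_circleMap {κ : ℝ} (hκ : κ ≠ 0) {p : UnitAddCircle → Prop}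
    (h : ∀ᵐ x ∂AddCircle.haarAddCircle, p x) : ∀ᵐ ξ : ℝ, p (circleMap κ ξ) :=
  (ae_comp_mul_iff hκ (p := fun w => p (w : UnitAddCircle))).2 (ae_coe_of_ae_haarAddCircle h)

lemma ae_restrict_circleMap_iff {κ L : ℝ} (hκ : κ ≠ 0) (hL : L = |κ|⁻¹)
    {p : UnitAddCircle → Prop} (hp : MeasurableSet {x | p x}) :
    (∀ᵐ ξ ∂(volume.restrict (Set.Icc 0 L)), p (circleMap κ ξ)) ↔
      ∀ᵐ x ∂AddCircle.haarAddCircle, p x := by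
  refine ⟨fun h => ae_haarAddCircle_of_ae_coe hp ((ae_comp_mul_iff hκ).1 ?_),
    fun h => ae_restrict_of_ae (ae_circleMap hκ h)⟩
  have hL0 : 0 < L := by rw [hL]; positivity
  refine ae_of_ae_restrict_of_periodic hL0 (fun ξ => ?_) h
  have : ((κ * (ξ + L) : ℝ) : UnitAddCircle) = ((κ * ξ : ℝ) : UnitAddCircle) := by
    rw [hL, mul_add, AddCircle.coe_add]
    rcases abs_cases κ with ⟨h1, -⟩ | ⟨h1, -⟩
    · rw [h1, mul_inv_cancel₀ hκ, AddCircle.coe_period, add_zero]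
    · rw [h1, inv_neg, mul_neg, mul_inv_cancel₀ hκ, AddCircle.coe_neg, AddCircle.coe_period,
        neg_zero, add_zero]
  rw [this]

lemma lintegral_eq_lintegral_tsum {f : ℝ → ℝ≥0∞} (hf : Measurable f) :
    ∫⁻ w, f w = ∫⁻ w in Set.Ioc (0 : ℝ) 1, ∑' n : ℤ, f (w + n) := by
  have h := (isAddFundamentalDomain_Ioc (T := (1 : ℝ)) one_pos 0 volume).lintegral_eq_tsum'' f
  let E : ℤ ≃ AddSubgroup.zmultiples (1 : ℝ) := Equiv.ofBijective
    (fun n => ⟨(n : ℝ), AddSubgroup.mem_zmultiples_iff.2 ⟨n, by simp⟩⟩)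
    ⟨fun m n hmn => by simpa using hmn, fun ⟨x, hx⟩ => by
      obtain ⟨n, hn⟩ := AddSubgroup.mem_zmultiples_iff.1 hx
      exact ⟨n, Subtype.ext (by simpa using hn)⟩⟩
  rw [h, ← E.tsum_eq, zero_add, lintegral_tsum fun n => (by fun_prop)]
  refine tsum_congr fun n => lintegral_congr fun w => ?_
  rw [add_comm]; rfl

lemma lintegral_circleMap_neg_one (f : UnitAddCircle → ℝ≥0∞) (hf : Measurable f) :
    ∫⁻ w in Set.Ioc (0 : ℝ) 1, f (circleMap (-1) w) = ∫⁻ x, f x ∂AddCircle.haarAddCircle := by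
  have h1 := (measurePreserving_coe_Ioc 0).lintegral_comp (hf.comp measurable_neg)
  rw [zero_add] at h1
  have h2 : ∫⁻ x, f (-x) ∂AddCircle.haarAddCircle = ∫⁻ x, f x ∂AddCircle.haarAddCircle :=
    lintegral_neg_eq_self f
  rw [← h2]
  refine Eq.trans (lintegral_congr fun w => ?_) h1
  simp [circleMap]

lemma lintegral_circleMap_mul {f : UnitAddCircle → ℝ≥0∞} (hf : Measurable f) {g : ℝ → ℝ≥0∞}
    (hg : Measurable g) :
    ∫⁻ w, f (circleMap (-1) w) * g w =
      ∫⁻ w in Set.Ioc (0 : ℝ) 1, f (circleMap (-1) w) * ∑' n : ℤ, g (w + n) := by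
  rw [lintegral_eq_lintegral_tsum (f := fun w => f (circleMap (-1) w) * g w)
    ((hf.comp (measurable_circleMap _)).mul hg)]
  refine lintegral_congr fun w => ?_
  rw [← ENNReal.tsum_mul_left]
  refine tsum_congr fun n => ?_
  congr 2
  simp only [circleMap, mul_add, AddCircle.coe_add]
  have : ((-1 * (n : ℝ) : ℝ) : UnitAddCircle) = 0 := by
    rw [AddCircle.coe_eq_zero_iff]
    exact ⟨-n, by simp⟩
  rw [this, add_zero]

/-- A bounded interval, scaled by `κ`, is covered by finitely many unit intervals, each of which
carries one copy of the integral over the circle. This passes from convergence on the circle to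
convergence on bounded intervals. -/
lemma exists_lintegral_circleMap_le (κ R : ℝ) (hκ : κ ≠ 0) :
    ∃ M : ℝ≥0, ∀ f : UnitAddCircle → ℝ≥0∞, Measurable f → ∫⁻ ξ in Set.Icc (-R) R, f (circleMap κ ξ) ≤
      M * ∫⁻ x, f x ∂AddCircle.haarAddCircle := by
  obtain ⟨N, hN⟩ := exists_nat_ge (|κ| * R)
  refine ⟨Real.toNNReal |κ⁻¹| * (Finset.Ico (-N - 1 : ℤ) (N + 1)).card, fun f hf => ?_⟩
  set s : Set ℝ := ⋃ n ∈ Finset.Ico (-N - 1 : ℤ) (N + 1), Set.Ioc (n : ℝ) (n + 1) with hs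
  have hms : MeasurableSet s := Finset.measurableSet_biUnion _ fun n _ => measurableSet_Ioc
  have hfm : Measurable fun w : ℝ => f (w : UnitAddCircle) :=
    hf.comp (AddCircle.continuous_mk' (1 : ℝ)).measurable
  have h1 : ∫⁻ ξ in Set.Icc (-R) R, f (circleMap κ ξ) ≤
      ∫⁻ ξ, s.indicator (fun w : ℝ => f (w : UnitAddCircle)) (κ * ξ) := by
    rw [← lintegral_indicator measurableSet_Icc]
    refine lintegral_mono fun ξ => ?_
    by_cases hξ : ξ ∈ Set.Icc (-R) R
    · have h2 : |κ * ξ| ≤ N := by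
        rw [abs_mul]
        exact (mul_le_mul_of_nonneg_left (abs_le.2 hξ) (abs_nonneg _)).trans hN
      have h3 : κ * ξ ∈ s := by
        rw [abs_le] at h2
        simp only [hs, Set.mem_iUnion, Finset.mem_Ico, Set.mem_Ioc]
        have h4 := Int.ceil_lt_add_one (κ * ξ)
        have h5 := Int.le_ceil (κ * ξ)
        -- The intervals `(n, n + 1]` are open on the left, so the index is the ceiling minus one;
        -- the point `-N` forces the range to start at `-N - 1`.
        refine ⟨⌈κ * ξ⌉ - 1, ⟨?_, ?_⟩, ?_, ?_⟩
        · have : (-N : ℝ) ≤ ⌈κ * ξ⌉ := h2.1.trans h5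
          have : (-N : ℤ) ≤ ⌈κ * ξ⌉ := by exact_mod_cast this
          omega
        · have : ⌈κ * ξ⌉ ≤ (N : ℤ) := Int.ceil_le.2 (by exact_mod_cast h2.2)
          omega
        · push_cast; linarith
        · push_cast; linarith
      rw [Set.indicator_of_mem hξ, Set.indicator_of_mem h3]
      rfl
    · rw [Set.indicator_of_notMem hξ]; exact zero_le
  have h2 : ∫⁻ ξ, s.indicator (fun w : ℝ => f (w : UnitAddCircle)) (κ * ξ) =
      ENNReal.ofReal |κ⁻¹| * ∫⁻ w in s, f (w : UnitAddCircle) := by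
    rw [← lintegral_indicator hms, ← smul_eq_mul, ← lintegral_smul_measure,
      ← Real.map_volume_mul_left hκ,
      lintegral_map (hfm.indicator hms) (measurable_const_mul κ)]
  have h3 : ∫⁻ w in s, f (w : UnitAddCircle) ≤
      (Finset.Ico (-N - 1 : ℤ) (N + 1)).card * ∫⁻ x, f x ∂AddCircle.haarAddCircle := by
    calc ∫⁻ w in s, f (w : UnitAddCircle)
        ≤ ∑ n ∈ Finset.Ico (-N - 1 : ℤ) (N + 1),
            ∫⁻ w in Set.Ioc (n : ℝ) (n + 1), f (w : UnitAddCircle) := by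
          have hs' : s = ⋃ n : {n // n ∈ Finset.Ico (-N - 1 : ℤ) (N + 1)},
              Set.Ioc ((n : ℤ) : ℝ) ((n : ℤ) + 1) := by
            rw [hs, Set.iUnion_subtype]
          rw [hs']
          refine (lintegral_iUnion_le _ _).trans (le_of_eq ?_)
          exact Finset.tsum_subtype (Finset.Ico (-N - 1 : ℤ) (N + 1))
            fun n => ∫⁻ w in Set.Ioc (n : ℝ) (n + 1), f (w : UnitAddCircle)
      _ = ∑ n ∈ Finset.Ico (-N - 1 : ℤ) (N + 1), ∫⁻ x, f x ∂AddCircle.haarAddCircle := by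
          refine Finset.sum_congr rfl fun n _ => ?_
          exact (measurePreserving_coe_Ioc (n : ℝ)).lintegral_comp hf
      _ = _ := by rw [Finset.sum_const, nsmul_eq_mul]
  refine h1.trans ?_
  rw [h2, ENNReal.coe_mul, mul_assoc]
  refine mul_le_mul' le_rfl (by exact_mod_cast h3)

end Periodization

/-! ### Multiplication of a function on the line by periodic functions -/

section PeriodicMul

/-- `L²` of the circle. -/
abbrev CircleL2 := Lp ℂ 2 (AddCircle.haarAddCircle : Measure UnitAddCircle)

variable {F : Lp ℂ 2 (volume : Measure ℝ)} {A B : ℝ}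

/-- The periodization of `|F|²` lies between `A` and `B`. -/
def PeriodizationBounds (F : Lp ℂ 2 (volume : Measure ℝ)) (A B : ℝ) : Prop :=
  ∀ᵐ w : ℝ, ENNReal.ofReal A ≤ ∑' n : ℤ, ‖F (w + n)‖ₑ ^ 2 ∧
    ∑' n : ℤ, ‖F (w + n)‖ₑ ^ 2 ≤ ENNReal.ofReal B

lemma measurable_enorm_sq {α : Type*} [MeasurableSpace α] {μ : Measure α} (f : Lp ℂ 2 μ) :
    Measurable fun x => ‖f x‖ₑ ^ 2 :=
  (Lp.stronglyMeasurable f).measurable.enorm.pow_const 2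

/-- Unfolding the integral over integer translates leaves the periodic factor unchanged and
periodizes `|F|²`; both norm bounds for `periodicMul` come from this identity. -/
lemma lintegral_periodicMul (D : CircleL2) :
    ∫⁻ w, ‖D (circleMap (-1) w) * F w‖ₑ ^ 2 =
      ∫⁻ w in Set.Ioc (0 : ℝ) 1, ‖D (circleMap (-1) w)‖ₑ ^ 2 * ∑' n : ℤ, ‖F (w + n)‖ₑ ^ 2 := by
  rw [← lintegral_circleMap_mul (measurable_enorm_sq D) (measurable_enorm_sq F)]
  simp_rw [enorm_mul, mul_pow]

lemma lintegral_periodicMul_le (h : PeriodizationBounds F A B) (D : CircleL2) :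
    ∫⁻ w, ‖D (circleMap (-1) w) * F w‖ₑ ^ 2 ≤ ENNReal.ofReal B * ‖D‖ₑ ^ 2 := by
  rw [lintegral_periodicMul, enorm_sq_eq_lintegral,
    ← lintegral_circleMap_neg_one _ (measurable_enorm_sq D),
    ← lintegral_const_mul (f := fun w => ‖D (circleMap (-1) w)‖ₑ ^ 2) _
      ((measurable_enorm_sq D).comp (measurable_circleMap _))]
  refine lintegral_mono_ae (ae_restrict_of_ae ?_)
  filter_upwards [h] with w hw
  rw [mul_comm]
  exact mul_le_mul' hw.2 le_rfl

lemma le_lintegral_periodicMul (h : PeriodizationBounds F A B) (D : CircleL2) :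
    ENNReal.ofReal A * ‖D‖ₑ ^ 2 ≤ ∫⁻ w, ‖D (circleMap (-1) w) * F w‖ₑ ^ 2 := by
  rw [lintegral_periodicMul, enorm_sq_eq_lintegral,
    ← lintegral_circleMap_neg_one _ (measurable_enorm_sq D),
    ← lintegral_const_mul (f := fun w => ‖D (circleMap (-1) w)‖ₑ ^ 2) _
      ((measurable_enorm_sq D).comp (measurable_circleMap _))]
  refine lintegral_mono_ae (ae_restrict_of_ae ?_)
  filter_upwards [h] with w hw
  rw [mul_comm (‖_‖ₑ ^ 2)]
  exact mul_le_mul' hw.1 le_rfl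

lemma memLp_two_of_lintegral {α : Type*} [MeasurableSpace α] {μ : Measure α} {f : α → ℂ}
    (hf : AEStronglyMeasurable f μ) (h : ∫⁻ x, ‖f x‖ₑ ^ 2 ∂μ < ∞) : MemLp f 2 μ := by
  refine ⟨hf, ?_⟩
  have h1 := eLpNorm_nnreal_pow_eq_lintegral (μ := μ) (f := f) (p := 2) (by norm_num)
  simp only [NNReal.coe_ofNat, ENNReal.coe_ofNat, ENNReal.rpow_ofNat] at h1
  rw [← h1] at h
  exact (ENNReal.pow_lt_top_iff.1 h).resolve_right (by norm_num)

lemma memLp_periodicMul (h : PeriodizationBounds F A B) (D : CircleL2) :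
    MemLp (fun w => D (circleMap (-1) w) * F w) 2 := by
  refine memLp_two_of_lintegral ?_ ?_
  · exact (((Lp.stronglyMeasurable D).measurable.comp (measurable_circleMap _)).mul
      (Lp.stronglyMeasurable F).measurable).aestronglyMeasurable
  · refine (lintegral_periodicMul_le h D).trans_lt (ENNReal.mul_lt_top ENNReal.ofReal_lt_top ?_)
    exact ENNReal.pow_lt_top enorm_lt_top

lemma norm_toLp_sq_eq {α : Type*} [MeasurableSpace α] {μ : Measure α} {f : α → ℂ}
    (hf : MemLp f 2 μ) : ENNReal.ofReal (‖hf.toLp f‖ ^ 2) = ∫⁻ x, ‖f x‖ₑ ^ 2 ∂μ := by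
  rw [ENNReal.ofReal_pow (norm_nonneg _), ofReal_norm, enorm_sq_eq_lintegral]
  refine lintegral_congr_ae ?_
  filter_upwards [hf.coeFn_toLp] with x hx
  rw [hx]

lemma norm_periodicMul_le (h : PeriodizationBounds F A B) (hB : 0 ≤ B) (D : CircleL2) :
    ‖(memLp_periodicMul h D).toLp _‖ ^ 2 ≤ B * ‖D‖ ^ 2 := by
  have h1 := lintegral_periodicMul_le h D
  rw [← norm_toLp_sq_eq (memLp_periodicMul h D), ← ofReal_mul_norm_sq hB] at h1
  exact (ENNReal.ofReal_le_ofReal_iff (by positivity)).1 h1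

lemma le_norm_periodicMul (h : PeriodizationBounds F A B) (hA : 0 ≤ A) (D : CircleL2) :
    A * ‖D‖ ^ 2 ≤ ‖(memLp_periodicMul h D).toLp _‖ ^ 2 := by
  have h1 := le_lintegral_periodicMul h D
  rw [← norm_toLp_sq_eq (memLp_periodicMul h D), ← ofReal_mul_norm_sq hA] at h1
  exact (ENNReal.ofReal_le_ofReal_iff (by positivity)).1 h1

/-- The operator `D ↦ D(-·) F` from `L²` of the circle to `L²(ℝ)`. -/
def periodicMul (h : PeriodizationBounds F A B) (hB : 0 ≤ B) :
    CircleL2 →L[ℂ] Lp ℂ 2 (volume : Measure ℝ) :=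
  LinearMap.mkContinuous
    { toFun := fun D => (memLp_periodicMul h D).toLp _
      map_add' := fun D E => by
        refine Lp.ext ?_
        filter_upwards [(memLp_periodicMul h (D + E)).coeFn_toLp,
          Lp.coeFn_add ((memLp_periodicMul h D).toLp _) ((memLp_periodicMul h E).toLp _),
          (memLp_periodicMul h D).coeFn_toLp, (memLp_periodicMul h E).coeFn_toLp,
          ae_circleMap (neg_ne_zero.2 one_ne_zero) (Lp.coeFn_add D E)] with w h1 h2 h3 h4 h5
        rw [h1, h2, Pi.add_apply, h3, h4, h5, Pi.add_apply, add_mul]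
      map_smul' := fun z D => by
        refine Lp.ext ?_
        filter_upwards [(memLp_periodicMul h (z • D)).coeFn_toLp,
          Lp.coeFn_smul z ((memLp_periodicMul h D).toLp _),
          (memLp_periodicMul h D).coeFn_toLp,
          ae_circleMap (neg_ne_zero.2 one_ne_zero) (Lp.coeFn_smul z D)] with w h1 h2 h3 h5
        rw [h1, RingHom.id_apply, h2, Pi.smul_apply, h3, h5, Pi.smul_apply, smul_eq_mul,
          smul_eq_mul, mul_assoc] }
    (√B) fun D => by
      refine le_of_sq_le_sq ?_ (by positivity)
      rw [mul_pow, Real.sq_sqrt hB]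
      exact norm_periodicMul_le h hB D

lemma coeFn_periodicMul (h : PeriodizationBounds F A B) (hB : 0 ≤ B) (D : CircleL2) :
    periodicMul h hB D =ᵐ[volume] fun w => D (circleMap (-1) w) * F w :=
  (memLp_periodicMul h D).coeFn_toLp

lemma antilipschitz_periodicMul (h : PeriodizationBounds F A B) (hA : 0 < A) (hB : 0 ≤ B) :
    ∃ M : ℝ≥0, AntilipschitzWith M (periodicMul h hB) := by
  refine ⟨⟨(√A)⁻¹, by positivity⟩, ContinuousLinearMap.antilipschitz_of_bound _ fun D => ?_⟩
  have h1 := le_norm_periodicMul h hA.le D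
  have h2 := Real.sqrt_le_sqrt h1
  rw [Real.sqrt_mul hA.le, Real.sqrt_sq (norm_nonneg _), Real.sqrt_sq (norm_nonneg _)] at h2
  change ‖D‖ ≤ (√A)⁻¹ * ‖periodicMul h hB D‖
  rw [le_inv_mul_iff₀ (Real.sqrt_pos.2 hA)]
  exact h2

end PeriodicMul

/-! ### The Fourier transform of a translate -/

section Translation

lemma continuous_modulation (x : ℝ) :
    Continuous fun w : ℝ => Complex.exp ((-2 * Real.pi * (x * w) : ℝ) * Complex.I) := by fun_prop

lemma memLp_modulation (x : ℝ) :
    MemLp (fun w : ℝ => Complex.exp ((-2 * Real.pi * (x * w) : ℝ) * Complex.I)) ∞ :=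
  memLp_top_of_bound (continuous_modulation x).aestronglyMeasurable 1
    (Eventually.of_forall fun _ => (Complex.norm_exp_ofReal_mul_I _).le)

/-- Translation by `x`. -/
def translate (x : ℝ) : Lp ℂ 2 (volume : Measure ℝ) →L[ℂ] Lp ℂ 2 (volume : Measure ℝ) :=
  (Lp.compMeasurePreservingₗᵢ ℂ (fun t : ℝ => t - x)
    (measurePreserving_sub_right volume x)).toContinuousLinearMap

lemma coeFn_translate (x : ℝ) (f : Lp ℂ 2 (volume : Measure ℝ)) :
    translate x f =ᵐ[volume] fun t => f (t - x) :=
  Lp.coeFn_compMeasurePreserving f (measurePreserving_sub_right volume x)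

/-- Both sides are continuous in `f`, so it is enough to treat Schwartz functions, where the Fourier
transform is an integral. -/
lemma fourier_translate (x : ℝ) (f : Lp ℂ 2 (volume : Measure ℝ)) :
    𝓕 (translate x f) = mulL (memLp_modulation x) (𝓕 f) := by
  let 𝓕L : Lp ℂ 2 (volume : Measure ℝ) →L[ℂ] Lp ℂ 2 (volume : Measure ℝ) :=
    (Lp.fourierTransformₗᵢ ℝ ℂ).toContinuousLinearEquiv
  have hd := SchwartzMap.denseRange_toLpCLM (E := ℝ) (F := ℂ) (p := 2)
    (μ := volume) ENNReal.ofNat_ne_top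
  have key : (𝓕L ∘L translate x : _ → _) = mulL (memLp_modulation x) ∘L 𝓕L := by
    refine hd.equalizer (ContinuousLinearMap.continuous _) (ContinuousLinearMap.continuous _) ?_
    funext g
    change 𝓕 (translate x (g.toLp 2)) = mulL (memLp_modulation x) (𝓕 (g.toLp 2))
    have h1 : translate x (g.toLp 2) = (g.compSubConstCLM ℂ x).toLp 2 := by
      refine Lp.ext ?_
      have h2 := (measurePreserving_sub_right volume x).quasiMeasurePreserving.ae
        (g.coeFn_toLp 2 volume)
      filter_upwards [coeFn_translate x (g.toLp 2), h2,
        (g.compSubConstCLM ℂ x).coeFn_toLp 2 volume] with t h3 h4 h5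
      rw [h3, h4, h5]; rfl
    rw [h1, SchwartzMap.toLp_fourier_eq, SchwartzMap.toLp_fourier_eq]
    refine (mulL_eq _ ?_).symm
    filter_upwards [(𝓕 (g.compSubConstCLM ℂ x)).coeFn_toLp 2 volume,
      (𝓕 g).coeFn_toLp 2 volume] with w h3 h4
    rw [h3, h4, SchwartzMap.fourier_coe, SchwartzMap.fourier_coe]
    have h5 := congrFun (VectorFourier.fourierIntegral_comp_add_right Real.fourierChar volume
      (innerₗ ℝ) (⇑g) (-x)) w
    have h6 : ⇑(SchwartzMap.compSubConstCLM ℂ x g) = ⇑g ∘ fun t => t + -x := by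
      ext t; simp [sub_eq_add_neg]
    rw [h6]
    refine h5.trans ?_
    rw [Circle.smul_def, smul_eq_mul, Real.fourierChar_apply]
    congr 2
    simp
    ring
  exact congrFun key f

end Translation

/-! ### The fractional Fourier transform as an operator -/

section Operator

lemma c_ne_zero (θ : ℝ) : c θ ≠ 0 := by
  have h : (1 - Complex.I * (Real.cot θ : ℂ)) ≠ 0 := fun h => by
    have := congrArg Complex.re h
    simp only [Complex.sub_re, Complex.one_re, Complex.mul_re, Complex.I_re, Complex.I_im,
      Complex.ofReal_re, Complex.ofReal_im, Complex.zero_re] at this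
    norm_num at this
  have h2 : (2 * (Real.pi : ℂ)) ≠ 0 := by
    simp [Real.pi_ne_zero]
  unfold c
  rw [Ne, Complex.cpow_eq_zero_iff]
  exact fun h' => div_ne_zero h h2 h'.1

lemma conj_chirp_mul (θ t : ℝ) : conj (chirp θ t) * chirp θ t = 1 := by
  rw [Complex.conj_mul', norm_chirp]; simp

lemma chirp_mul_conj (θ t : ℝ) : chirp θ t * conj (chirp θ t) = 1 := by
  rw [mul_comm, conj_chirp_mul]

lemma chirp_ne_zero (θ t : ℝ) : chirp θ t ≠ 0 := left_ne_zero_of_mul_eq_one (chirp_mul_conj θ t)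

lemma norm_eta (θ t : ℝ) : ‖eta θ t‖ = ‖c θ‖ := by simp [eta, norm_chirp]

lemma memLp_chirp (θ : ℝ) : MemLp (chirp θ) ∞ :=
  memLp_top_of_bound (continuous_chirp θ).aestronglyMeasurable 1
    (Eventually.of_forall fun t => (norm_chirp θ t).le)

/-- Multiplication by the chirp. -/
def chirpEquiv (θ : ℝ) : Lp ℂ 2 (volume : Measure ℝ) ≃L[ℂ] Lp ℂ 2 (volume : Measure ℝ) :=
  mulEquiv (memLp_chirp θ) (m' := fun t => conj (chirp θ t)) (memLp_chirp θ).star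
    (Eventually.of_forall fun t => chirp_mul_conj θ t)

lemma coeFn_chirpEquiv (θ : ℝ) (f : Lp ℂ 2 (volume : Measure ℝ)) :
    chirpEquiv θ f =ᵐ[volume] modulate θ f := coeFn_mulL (memLp_chirp θ) f

/-- `f ↦ 𝓕 (λ_θ f)` on `L²(ℝ)`. -/
def chirpFourier (θ : ℝ) : Lp ℂ 2 (volume : Measure ℝ) ≃L[ℂ] Lp ℂ 2 (volume : Measure ℝ) :=
  (chirpEquiv θ).trans (Lp.fourierTransformₗᵢ ℝ ℂ).toContinuousLinearEquiv

lemma chirpFourier_apply (θ : ℝ) (f : Lp ℂ 2 (volume : Measure ℝ)) :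
    chirpFourier θ f = 𝓕 (chirpEquiv θ f) := rfl

lemma frft_eq (θ : ℝ) (f : Lp ℂ 2 (volume : Measure ℝ)) (ξ : ℝ) :
    frft θ f ξ = c θ * chirp θ ξ * chirpFourier θ f (b θ * ξ / (2 * Real.pi)) := by
  have h : (memLp_modulate θ (Lp.memLp f)).toLp (modulate θ f) = chirpEquiv θ f :=
    Lp.ext ((memLp_modulate θ (Lp.memLp f)).coeFn_toLp.trans (coeFn_chirpEquiv θ f).symm)
  rw [frft, h, chirpFourier_apply]

variable {θ : ℝ} {φ : ℝ → ℂ} (hφ : MemLp φ 2 volume)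

lemma b_mul_Δ (hθ : Real.sin θ ≠ 0) :
    b θ * Δ θ / (2 * Real.pi) = 1 ∨ b θ * Δ θ / (2 * Real.pi) = -1 := by
  have hpi := Real.pi_ne_zero
  unfold b Δ
  rcases abs_cases (Real.sin θ) with ⟨h, -⟩ | ⟨h, -⟩
  · left; rw [h]; field_simp
  · right; rw [h]; field_simp

/-- A shift of `ξ` by `Δ` shifts `b ξ / 2π` by `1` or `-1`, according to the sign of `sin θ`; in the
second case the sum is reindexed by `n ↦ -n`. -/
lemma G_eq (hθ : Real.sin θ ≠ 0) (ξ : ℝ) :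
    G θ hφ ξ = ‖c θ‖ₑ ^ 2 *
      ∑' n : ℤ, ‖chirpFourier θ (hφ.toLp φ) (b θ * ξ / (2 * Real.pi) + n)‖ₑ ^ 2 := by
  have h1 : ∀ t, ‖chirp θ t‖ₑ = 1 := fun t => by
    rw [← ofReal_norm, norm_chirp, ENNReal.ofReal_one]
  unfold G
  simp_rw [frft_eq, enorm_mul, h1, mul_one, mul_pow]
  rw [ENNReal.tsum_mul_left]
  congr 1
  have h2 : ∀ n : ℤ, b θ * (ξ + n * Δ θ) / (2 * Real.pi) =
      b θ * ξ / (2 * Real.pi) + n * (b θ * Δ θ / (2 * Real.pi)) := fun n => by ring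
  simp_rw [h2]
  rcases b_mul_Δ hθ with h | h <;> rw [h]
  · simp
  · rw [← (Equiv.neg ℤ).tsum_eq]
    simp

lemma Δ_pos (hθ : Real.sin θ ≠ 0) : 0 < Δ θ := by
  unfold Δ; positivity

lemma G_periodic (ξ : ℝ) : G θ hφ (ξ + Δ θ) = G θ hφ ξ := by
  unfold G
  rw [← (Equiv.addRight (1 : ℤ)).tsum_eq (fun n : ℤ => ‖frft θ (hφ.toLp φ) (ξ + n * Δ θ)‖ₑ ^ 2)]
  refine tsum_congr fun n => ?_
  congr 3
  simp only [Equiv.coe_addRight, Int.cast_add, Int.cast_one]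
  ring

lemma periodizationBounds (hθ : Real.sin θ ≠ 0) {A B : ℝ}
    (hG : ∀ᵐ ξ ∂(volume.restrict (Set.Icc 0 (Δ θ))),
      ENNReal.ofReal A ≤ G θ hφ ξ ∧ G θ hφ ξ ≤ ENNReal.ofReal B) :
    PeriodizationBounds (chirpFourier θ (hφ.toLp φ)) (A / ‖c θ‖ ^ 2) (B / ‖c θ‖ ^ 2) := by
  have hc : 0 < ‖c θ‖ ^ 2 := by have := norm_pos_iff.2 (c_ne_zero θ); positivity
  have h1 := ae_of_ae_restrict_of_periodic (Δ_pos hθ)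
    (fun ξ => by rw [G_periodic hφ ξ]) hG
  have hκ : b θ / (2 * Real.pi) ≠ 0 :=
    div_ne_zero (inv_ne_zero hθ) (mul_ne_zero two_ne_zero Real.pi_ne_zero)
  refine (ae_comp_mul_iff hκ).1 ?_
  filter_upwards [h1] with ξ hξ
  have e : b θ / (2 * Real.pi) * ξ = b θ * ξ / (2 * Real.pi) := by ring
  have hc' : ‖c θ‖ₑ ^ 2 = ENNReal.ofReal (‖c θ‖ ^ 2) := by
    rw [ENNReal.ofReal_pow (norm_nonneg _), ofReal_norm]
  rw [G_eq hφ hθ, hc'] at hξ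
  rw [e, ENNReal.ofReal_div_of_pos hc, ENNReal.ofReal_div_of_pos hc]
  have hc0 : ENNReal.ofReal (‖c θ‖ ^ 2) ≠ 0 := (ENNReal.ofReal_pos.2 hc).ne'
  exact ⟨ENNReal.div_le_of_le_mul' hξ.1,
    (ENNReal.le_div_iff_mul_le (Or.inl hc0) (Or.inl ENNReal.ofReal_ne_top)).2
      (by rw [mul_comm]; exact hξ.2)⟩

variable {A B : ℝ} (hF : PeriodizationBounds (chirpFourier θ (hφ.toLp φ)) A B)

/-- The synthesis operator of the generators, on `L²` of the circle. -/
def synth (hB : 0 ≤ B) : CircleL2 →L[ℂ] Lp ℂ 2 (volume : Measure ℝ) :=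
  ((chirpFourier θ).symm : _ →L[ℂ] Lp ℂ 2 (volume : Measure ℝ)) ∘L (c θ • periodicMul hF hB)

lemma chirpFourier_synth (hB : 0 ≤ B) (D : CircleL2) :
    chirpFourier θ (synth hφ hF hB D) = c θ • periodicMul hF hB D := by
  simp [synth]

/-- The chirp in `genLp` cancels against the chirp of `chirpEquiv`, leaving a pure translate of `λ_θ
φ`. Its transform carries the factor `exp(-2πi n w)`, the `n`-th character at `-w`; hence the sign
in `circleMap (-1)`. -/
lemma synth_fourierBasis (hB : 0 ≤ B) (n : ℤ) :
    synth hφ hF hB (fourierBasis n) = genLp θ hφ n := by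
  apply (chirpFourier θ).injective
  rw [chirpFourier_synth]
  have h1 : chirpEquiv θ (genLp θ hφ n) = c θ • translate n (chirpEquiv θ (hφ.toLp φ)) := by
    refine Lp.ext ?_
    have hn := (measurePreserving_sub_right volume (n : ℝ)).quasiMeasurePreserving
    filter_upwards [coeFn_chirpEquiv θ (genLp θ hφ n), (memLp_gen θ hφ n).coeFn_toLp,
      Lp.coeFn_smul (c θ) (translate n (chirpEquiv θ (hφ.toLp φ))),
      coeFn_translate n (chirpEquiv θ (hφ.toLp φ)),
      hn.ae (coeFn_chirpEquiv θ (hφ.toLp φ)), hn.ae hφ.coeFn_toLp] with t h1 h2 h3 h4 h5 h6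
    rw [h1, h3, Pi.smul_apply, h4, h5, modulate, modulate, h6, genLp, h2, gen, eta, modulate,
      smul_eq_mul]
    linear_combination (c θ * chirp θ (t - n) * φ (t - n)) * chirp_mul_conj θ t
  have h2 : chirpFourier θ (genLp θ hφ n) =
      c θ • mulL (memLp_modulation n) (chirpFourier θ (hφ.toLp φ)) := by
    rw [chirpFourier_apply, h1, chirpFourier_apply, ← fourier_translate]
    exact (Lp.fourierTransformₗᵢ ℝ ℂ).map_smul _ _
  rw [h2]
  congr 1
  refine (mulL_eq _ ?_).symm
  have h3 : (fourierBasis n : CircleL2) =ᵐ[AddCircle.haarAddCircle] fourier n := by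
    rw [coe_fourierBasis]; exact coeFn_fourierLp 2 n
  filter_upwards [coeFn_periodicMul hF hB (fourierBasis n),
    ae_circleMap (neg_ne_zero.2 one_ne_zero) h3] with w h4 h5
  rw [h4, h5, circleMap, fourier_coe_apply]
  congr 2
  push_cast
  ring

lemma antilipschitz_synth (hA : 0 < A) (hB : 0 ≤ B) :
    ∃ M : ℝ≥0, AntilipschitzWith M (synth hφ hF hB) := by
  obtain ⟨M, hM⟩ := antilipschitz_periodicMul hF hA hB
  have hc : AntilipschitzWith ‖c θ‖₊⁻¹ (fun f : Lp ℂ 2 (volume : Measure ℝ) => c θ • f) := by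
    refine AntilipschitzWith.of_le_mul_nndist fun f g => ?_
    rw [nndist_smul₀, inv_mul_cancel_left₀ (nnnorm_ne_zero_iff.2 (c_ne_zero θ))]
  exact ⟨_, (chirpFourier θ).symm.antilipschitz.comp (hc.comp hM)⟩

/-- The range is closed because the operator is bounded below, and it contains the generators.
Conversely, the trigonometric polynomials are dense and map into the span of the generators. -/
lemma range_synth (hA : 0 < A) (hB : 0 ≤ B) :
    (synth hφ hF hB).range = V θ hφ := by
  obtain ⟨M, hM⟩ := antilipschitz_synth hφ hF hA hB
  have hcl : IsClosed (Set.range (synth hφ hF hB)) :=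
    hM.isClosed_range (synth hφ hF hB).uniformContinuous
  have hr : Set.range (genLp θ hφ) = synth hφ hF hB '' Set.range (fourierBasis (T := (1 : ℝ))) := by
    rw [← Set.range_comp]
    congr 1
    ext1 n
    exact (synth_fourierBasis hφ hF hB n).symm
  refine le_antisymm ?_ ?_
  · rintro _ ⟨D, rfl⟩
    have hD : D ∈ (Submodule.span ℂ
        (Set.range (fourierBasis (T := (1 : ℝ))))).topologicalClosure := by
      rw [HilbertBasis.dense_span]; trivial
    rw [V, hr]
    change _ ∈ closure _
    have h1 := image_closure_subset_closure_image (synth hφ hF hB).continuous ⟨D, hD, rfl⟩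
    have h2 := Submodule.map_span (synth hφ hF hB).toLinearMap
      (Set.range (fourierBasis (T := (1 : ℝ))))
    convert h1 using 2
    · exact congrArg SetLike.coe h2.symm
    · rfl
  · refine Submodule.topologicalClosure_minimal _ (Submodule.span_le.2 ?_) hcl
    rintro _ ⟨n, rfl⟩
    exact ⟨fourierBasis n, synth_fourierBasis hφ hF hB n⟩

instance : CompleteSpace (V θ hφ) :=
  (Submodule.isClosed_topologicalClosure _).completeSpace_coe

/-- The synthesis operator as an isomorphism onto `V_θ(φ)`. -/
def synthEquiv (hA : 0 < A) (hB : 0 ≤ B) : CircleL2 ≃L[ℂ] V θ hφ :=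
  ContinuousLinearEquiv.ofBijective
    ((synth hφ hF hB).codRestrict (V θ hφ) fun D => by
      rw [← range_synth hφ hF hA hB]; exact ⟨D, rfl⟩)
    (LinearMap.ker_eq_bot.2 fun D E h => by
      obtain ⟨M, hM⟩ := antilipschitz_synth hφ hF hA hB
      exact hM.injective (congrArg Subtype.val h))
    (LinearMap.range_eq_top.2 fun f => by
      obtain ⟨D, hD⟩ := (range_synth hφ hF hA hB).ge f.2
      exact ⟨D, Subtype.ext hD⟩)

lemma coe_synthEquiv (hA : 0 < A) (hB : 0 ≤ B) (D : CircleL2) :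
    (synthEquiv hφ hF hA hB D : Lp ℂ 2 (volume : Measure ℝ)) = synth hφ hF hB D := rfl

end Operator

lemma hasSum_of_forall_eq {ι : Type*} {f g : ι → ℂ} {z : ℂ} (hf : HasSum f z)
    (h : ∀ j, g j = f j) : HasSum g z := by
  rwa [show g = f from funext h]

/-! ### Point values -/

section Values

variable {θ : ℝ} {φ : ℝ → ℂ}

lemma summable_norm_modulate_sq {t : ℝ} (hC : C θ φ t < ∞) :
    Summable fun n : ℤ => ‖modulate θ φ (t - n)‖ ^ 2 := by
  have h : ∑' n : ℤ, ((‖modulate θ φ (t - n)‖₊ ^ 2 : ℝ≥0) : ℝ≥0∞) ≠ ∞ := by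
    simpa [C, enorm_eq_nnnorm] using hC.ne
  simpa using NNReal.summable_coe.2 (ENNReal.tsum_coe_ne_top_iff_summable.1 h)

lemma tsum_norm_modulate_sq (t : ℝ) :
    ∑' n : ℤ, ‖modulate θ φ (t - n)‖ ^ 2 = (C θ φ t).toReal := by
  rw [C, ENNReal.tsum_toReal_eq fun n => by finiteness]
  simp

lemma norm_gen_sq (n : ℤ) (t : ℝ) :
    ‖gen θ φ n t‖ ^ 2 = ‖c θ‖ ^ 2 * ‖modulate θ φ (t - n)‖ ^ 2 := by
  rw [gen, norm_mul, norm_eta, mul_pow]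

lemma summable_norm_gen_sq {t : ℝ} (hC : C θ φ t < ∞) :
    Summable fun n : ℤ => ‖conj (gen θ φ n t)‖ ^ 2 := by
  simp_rw [RCLike.norm_conj, norm_gen_sq]
  exact (summable_norm_modulate_sq hC).mul_left _

/-- The evaluation at `t`, as an element of `L²` of the circle. -/
def kernel (hC : ∀ t, C θ φ t < ∞) (t : ℝ) : CircleL2 :=
  (HilbertBasis.exists_hasSum_smul fourierBasis (summable_norm_gen_sq (hC t))).choose

lemma inner_fourierBasis_kernel (hC : ∀ t, C θ φ t < ∞) (t : ℝ) (n : ℤ) :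
    inner ℂ (fourierBasis n) (kernel hC t) = conj (gen θ φ n t) :=
  (HilbertBasis.exists_hasSum_smul fourierBasis
    (summable_norm_gen_sq (hC t))).choose_spec.2.1 n

lemma norm_kernel_sq (hC : ∀ t, C θ φ t < ∞) (t : ℝ) :
    ‖kernel hC t‖ ^ 2 = ‖c θ‖ ^ 2 * (C θ φ t).toReal := by
  have h := (HilbertBasis.exists_hasSum_smul (fourierBasis (T := (1 : ℝ)))
    (summable_norm_gen_sq (hC t))).choose_spec.2.2
  rw [kernel, h]
  simp_rw [RCLike.norm_conj, norm_gen_sq]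
  rw [tsum_mul_left, tsum_norm_modulate_sq]

lemma hasSum_inner_kernel (hC : ∀ t, C θ φ t < ∞) (t : ℝ) (D : CircleL2) :
    HasSum (fun n : ℤ => inner ℂ (fourierBasis n) D * gen θ φ n t) (inner ℂ (kernel hC t) D) := by
  have h := (fourierBasis (T := (1 : ℝ))).hasSum_inner_mul_inner (kernel hC t) D
  have hn : ∀ n : ℤ, inner ℂ (kernel hC t) (fourierBasis n : CircleL2) = gen θ φ n t := fun n => by
    rw [← inner_conj_symm, inner_fourierBasis_kernel hC, Complex.conj_conj]
  simp_rw [hn] at h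
  simpa only [mul_comm] using h

variable (hφ : MemLp φ 2 volume) {A B : ℝ}
  (hF : PeriodizationBounds (chirpFourier θ (hφ.toLp φ)) A B)

lemma hasSum_synth (hB : 0 ≤ B) (D : CircleL2) :
    HasSum (fun n : ℤ => inner ℂ (fourierBasis n) D • genLp θ hφ n) (synth hφ hF hB D) := by
  have h := (synth hφ hF hB).hasSum (fourierBasis.hasSum_repr D)
  simpa only [map_smul, synth_fourierBasis, HilbertBasis.repr_apply_apply] using h

/-- Injectivity of the synthesis operator determines the coefficients `d` from the element of
`V_θ(φ)`, and the coefficients determine the pointwise sum. This gives well-defined point values. -/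
lemma represents_synthEquiv_iff (hC : ∀ t, C θ φ t < ∞) (hA : 0 < A) (hB : 0 ≤ B)
    (D : CircleL2) (g : ℝ → ℂ) :
    Represents θ hφ (synthEquiv hφ hF hA hB D) g ↔ g = fun t => inner ℂ (kernel hC t) D := by
  constructor
  · rintro ⟨d, hd, h1, h2⟩
    obtain ⟨E, hE, hE', -⟩ := HilbertBasis.exists_hasSum_smul (fourierBasis (T := (1 : ℝ))) hd
    have h3 := (synth hφ hF hB).hasSum hE
    simp only [map_smul, synth_fourierBasis] at h3
    have h4 : E = D := (synthEquiv hφ hF hA hB).injective (Subtype.ext (h3.unique h1))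
    subst h4
    ext1 t
    have h5 := hasSum_inner_kernel hC t E
    simp_rw [hE'] at h5
    exact (h2 t).unique h5
  · rintro rfl
    refine ⟨fun n => inner ℂ (fourierBasis n) D, ?_, hasSum_synth hφ hF hB D,
      fun t => hasSum_inner_kernel hC t D⟩
    have h := (HilbertBasis.hasSum_norm_inner_sq fourierBasis D).summable
    simpa only [norm_inner_symm] using h

lemma existsUnique_represents
    (hF : PeriodizationBounds (chirpFourier θ (hφ.toLp φ)) A B)
    (hC : ∀ t, C θ φ t < ∞) (hA : 0 < A) (hB : 0 ≤ B)
    (f : V θ hφ) : ∃! g : ℝ → ℂ, Represents θ hφ f g := by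
  obtain ⟨D, rfl⟩ := (synthEquiv hφ hF hA hB).surjective f
  simp_rw [represents_synthEquiv_iff hφ hF hC]
  exact existsUnique_eq

lemma value_synthEquiv (hC : ∀ t, C θ φ t < ∞) (hA : 0 < A) (hB : 0 ≤ B) (D : CircleL2) (t : ℝ) :
    value θ hφ (synthEquiv hφ hF hA hB D) t = inner ℂ (kernel hC t) D := by
  have h : ∃ g, Represents θ hφ (synthEquiv hφ hF hA hB D) g :=
    ⟨_, (represents_synthEquiv_iff hφ hF hC hA hB D _).2 rfl⟩
  rw [value, dif_pos h]
  exact congrFun ((represents_synthEquiv_iff hφ hF hC hA hB D _).1 h.choose_spec) t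

/-- The partial sums converge to the synthesized function in `L²` and to `0` at every point. A
subsequence converges almost everywhere to the `L²` limit, which is therefore zero. -/
lemma eq_zero_of_inner_kernel
    (hF : PeriodizationBounds (chirpFourier θ (hφ.toLp φ)) A B)
    (hC : ∀ t, C θ φ t < ∞) (hA : 0 < A) (hB : 0 ≤ B) (D : CircleL2)
    (hD : ∀ t, inner ℂ (kernel hC t) D = 0) : D = 0 := by
  -- Extracting an almost everywhere convergent subsequence requires a sequence in place of the net
  -- of finite sets.
  obtain ⟨s, hs⟩ := exists_seq_tendsto (atTop : Filter (Finset ℤ))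
  have h1 := (hasSum_synth hφ hF hB D).comp hs
  obtain ⟨ns, hns, h2⟩ := (tendstoInMeasure_of_tendsto_Lp h1).exists_seq_tendsto_ae
  have h3 : ∀ i, ((∑ n ∈ s i, inner ℂ (fourierBasis n) D • genLp θ hφ n :
      Lp ℂ 2 (volume : Measure ℝ)) : ℝ → ℂ) =ᵐ[volume]
      fun t => ∑ n ∈ s i, inner ℂ (fourierBasis n) D * gen θ φ n t := by
    intro i
    have h4 : ∀ n : ℤ, ∀ᵐ t, genLp θ hφ n t = gen θ φ n t := fun n =>
      (memLp_gen θ hφ n).coeFn_toLp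
    have h5 : ∀ n : ℤ, ∀ᵐ t, (inner ℂ (fourierBasis n) D • genLp θ hφ n :
        Lp ℂ 2 (volume : Measure ℝ)) t = inner ℂ (fourierBasis n) D * genLp θ hφ n t := fun n =>
      Lp.coeFn_smul _ _
    filter_upwards [Lp.coeFn_finsetSum (s i)
      (fun n => (inner ℂ (fourierBasis n) D • genLp θ hφ n : Lp ℂ 2 (volume : Measure ℝ))),
      ae_all_iff.2 h4, ae_all_iff.2 h5] with t h6 h7 h8
    rw [h6, Finset.sum_apply]
    exact Finset.sum_congr rfl fun n _ => by rw [h8, h7]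
  have h4 : synth hφ hF hB D = 0 := by
    refine Lp.ext ?_
    filter_upwards [h2, ae_all_iff.2 h3, Lp.coeFn_zero ℂ 2 (volume : Measure ℝ)] with t h5 h6 h7
    rw [h7]
    have h8 := ((hasSum_inner_kernel hC t D).comp hs).comp hns.tendsto_atTop
    rw [hD] at h8
    refine tendsto_nhds_unique (h5.congr fun i => ?_) h8
    exact h6 (ns i)
  exact (synthEquiv hφ hF hA hB).map_eq_zero_iff.1 (Subtype.ext h4)

end Values

/-! ### The samples -/

section Samples

variable {θ : ℝ} {φ : ℝ → ℂ} {σ : ℝ}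

lemma summable_norm_samples_sq (hC : C θ φ σ < ∞) :
    Summable fun n : ℤ => ‖modulate θ φ (σ + n)‖ ^ 2 := by
  have h := (Equiv.neg ℤ).summable_iff.2 (summable_norm_modulate_sq hC)
  simpa [Function.comp_def] using h

/-- The Fourier series with the coefficients `λ_θ(σ + n) φ(σ + n)`. -/
def symbol (hC : C θ φ σ < ∞) : CircleL2 :=
  (HilbertBasis.exists_hasSum_smul fourierBasis (summable_norm_samples_sq hC)).choose

lemma hasSum_symbol (hC : C θ φ σ < ∞) :
    HasSum (fun n : ℤ => modulate θ φ (σ + n) • (fourierBasis n : CircleL2)) (symbol hC) :=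
  (HilbertBasis.exists_hasSum_smul fourierBasis (summable_norm_samples_sq hC)).choose_spec.1

lemma inner_fourierBasis_symbol (hC : C θ φ σ < ∞) (n : ℤ) :
    inner ℂ (fourierBasis n) (symbol hC) = modulate θ φ (σ + n) :=
  (HilbertBasis.exists_hasSum_smul fourierBasis (summable_norm_samples_sq hC)).choose_spec.2.1 n

lemma coeFn_fourierBasis (n : ℤ) :
    (fourierBasis n : CircleL2) =ᵐ[AddCircle.haarAddCircle] fourier n := by
  rw [coe_fourierBasis]; exact coeFn_fourierLp 2 n

lemma norm_fourier_apply (n : ℤ) (x : UnitAddCircle) : ‖fourier n x‖ = 1 := by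
  rw [fourier_apply]; exact Circle.norm_coe _

lemma memLp_fourier (n : ℤ) :
    MemLp (fourier n : UnitAddCircle → ℂ) ∞ AddCircle.haarAddCircle :=
  memLp_top_of_bound (fourier n).continuous.aestronglyMeasurable 1
    (Eventually.of_forall fun x => (norm_fourier_apply n x).le)

lemma inner_fourierBasis_mulL_fourier (D : CircleL2) (n m : ℤ) :
    inner ℂ (fourierBasis m) (mulL (memLp_fourier n) D) = inner ℂ (fourierBasis (m - n)) D := by
  rw [L2.inner_def, L2.inner_def]
  refine integral_congr_ae ?_
  filter_upwards [coeFn_mulL (memLp_fourier n) D, coeFn_fourierBasis m,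
    coeFn_fourierBasis (m - n)] with x h1 h2 h3
  rw [h1, h2, h3]
  simp only [RCLike.inner_apply]
  rw [sub_eq_add_neg, fourier_add, map_mul, ← fourier_neg, ← fourier_neg, neg_neg]
  ring

/-- `⟪e n, D P⟫` is rewritten as `⟪e n * conj D, P⟫`, an inner product of two `L²` functions, and
expanded by Parseval. Thus `P` need not be bounded. -/
lemma hasSum_convolution (hC : C θ φ σ < ∞) {D y : CircleL2}
    (hy : y =ᵐ[AddCircle.haarAddCircle] fun x => D x * symbol hC x) (n : ℤ) :
    HasSum (fun j : ℤ => inner ℂ (fourierBasis j) D * modulate θ φ (σ + n - j))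
      (inner ℂ (fourierBasis n) y) := by
  have hD : MemLp (fun x => conj (D x)) 2 AddCircle.haarAddCircle := (Lp.memLp D).star
  let E : CircleL2 := mulL (memLp_fourier n) (hD.toLp _)
  have hE : E =ᵐ[AddCircle.haarAddCircle] fun x => fourier n x * conj (D x) := by
    filter_upwards [coeFn_mulL (memLp_fourier n) (hD.toLp _), hD.coeFn_toLp] with x h1 h2
    rw [h1, h2]
  have h1 : inner ℂ E (symbol hC) = inner ℂ (fourierBasis n) y := by
    rw [L2.inner_def, L2.inner_def]
    refine integral_congr_ae ?_
    filter_upwards [hE, hy, coeFn_fourierBasis n] with x h1 h2 h3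
    rw [h1, h2, h3]
    simp only [RCLike.inner_apply, map_mul, Complex.conj_conj]
    ring
  have h2 : ∀ j : ℤ, inner ℂ E (fourierBasis j) = inner ℂ (fourierBasis (n - j)) D := fun j => by
    rw [L2.inner_def, L2.inner_def]
    refine integral_congr_ae ?_
    filter_upwards [hE, coeFn_fourierBasis j, coeFn_fourierBasis (n - j)] with x h1 h2 h3
    rw [h1, h2, h3]
    simp only [RCLike.inner_apply, map_mul, Complex.conj_conj]
    rw [sub_eq_add_neg, fourier_add, map_mul, ← fourier_neg, ← fourier_neg, neg_neg]
    ring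
  have h3 := fourierBasis.hasSum_inner_mul_inner E (symbol hC)
  rw [h1, ← (Equiv.subLeft n).hasSum_iff] at h3
  refine hasSum_of_forall_eq h3 fun j => ?_
  simp only [Function.comp_apply, Equiv.subLeft_apply, h2, inner_fourierBasis_symbol]
  rw [sub_sub_cancel]
  push_cast
  ring_nf

lemma samplingSystem (hφ : MemLp φ 2 volume) {A B : ℝ}
    (hF : PeriodizationBounds (chirpFourier θ (hφ.toLp φ)) A B) (hC : ∀ t, C θ φ t < ∞)
    (hA : 0 < A) (hB : 0 ≤ B) :
    SamplingSystem (fourierBasis (T := (1 : ℝ))) (symbol (hC σ)) (kernel hC)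
      (fun n : ℤ => σ + n) (fun n : ℤ => eta θ (σ + n)) ‖c θ‖ where
  memLp := Lp.memLp _
  pos := norm_pos_iff.2 (c_ne_zero θ)
  norm_eq n := norm_eta θ _
  ext := eq_zero_of_inner_kernel hφ hF hC hA hB
  sample n D y hy := by
    have h1 := (hasSum_convolution (hC σ) hy n).mul_left (eta θ (σ + n))
    refine (hasSum_inner_kernel hC (σ + n) D).unique ?_
    refine hasSum_of_forall_eq h1 fun j => ?_
    rw [gen]
    ring

/-- Multiplication by a character shifts the coefficients, and up to the factor `η_θ` this
translates the synthesized function by `n`. -/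
lemma inner_kernel_mulL_fourier (hC : ∀ t, C θ φ t < ∞) (D : CircleL2) (n : ℤ) (t : ℝ) :
    eta θ (t - n) * inner ℂ (kernel hC t) (mulL (memLp_fourier n) D) =
      eta θ t * inner ℂ (kernel hC (t - n)) D := by
  have h1 := (hasSum_inner_kernel hC t (mulL (memLp_fourier n) D)).mul_left (eta θ (t - n))
  have h2 := (hasSum_inner_kernel hC (t - n) D).mul_left (eta θ t)
  rw [← (Equiv.addRight n).hasSum_iff] at h1
  refine h1.unique ?_
  refine hasSum_of_forall_eq h2 fun j => ?_
  simp only [Function.comp_apply, Equiv.coe_addRight, inner_fourierBasis_mulL_fourier,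
    add_sub_cancel_right, gen]
  push_cast
  rw [show t - ((j : ℝ) + n) = t - n - j by ring]
  ring

end Samples

/-! ### The fractional Zak transform -/

section Zak

variable {θ : ℝ} {φ : ℝ → ℂ} {σ : ℝ}

/-- The frequency scaling `-b / 2π`. -/
def freq (θ : ℝ) : ℝ := -(b θ / (2 * Real.pi))

lemma freq_ne_zero (hθ : Real.sin θ ≠ 0) : freq θ ≠ 0 :=
  neg_ne_zero.2 (div_ne_zero (inv_ne_zero hθ) (mul_ne_zero two_ne_zero Real.pi_ne_zero))

lemma Δ_eq (θ : ℝ) : Δ θ = |freq θ|⁻¹ := by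
  unfold freq b Δ
  rw [abs_neg, abs_div, abs_inv, inv_div, div_inv_eq_mul, abs_of_pos Real.two_pi_pos]

/-- The fractional Zak transform in terms of the Fourier series of the samples. -/
def zakSeries (θ : ℝ) (D : CircleL2) (ξ : ℝ) : ℂ :=
  conj (c θ) * conj (chirp θ ξ) * D (circleMap (freq θ) ξ)

lemma norm_zakSeries (D : CircleL2) (ξ : ℝ) :
    ‖zakSeries θ D ξ‖ = ‖c θ‖ * ‖D (circleMap (freq θ) ξ)‖ := by
  simp [zakSeries, norm_chirp]

lemma measurable_zakSeries (D : CircleL2) : Measurable (zakSeries θ D) := by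
  have h1 := (Lp.stronglyMeasurable D).measurable.comp (measurable_circleMap (freq θ))
  have h2 : Measurable fun ξ => conj (chirp θ ξ) :=
    (Complex.continuous_conj.comp (continuous_chirp θ)).measurable
  exact (h2.const_mul _).mul h1

lemma exists_eLpNorm_zakSeries_le (hθ : Real.sin θ ≠ 0) (R : ℝ) : ∃ M : ℝ≥0, ∀ D : CircleL2,
    eLpNorm (zakSeries θ D) 2 (volume.restrict (Set.Icc (-R) R)) ≤ M * ‖D‖ₑ := by
  obtain ⟨M, hM⟩ := exists_lintegral_circleMap_le (freq θ) R (freq_ne_zero hθ)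
  refine ⟨‖c θ‖₊ * NNReal.sqrt M, fun D => ?_⟩
  refine (ENNReal.pow_le_pow_left_iff two_ne_zero).1 ?_
  have h1 := eLpNorm_nnreal_pow_eq_lintegral (μ := volume.restrict (Set.Icc (-R) R))
    (f := zakSeries θ D) (p := 2) (by norm_num)
  simp only [NNReal.coe_ofNat, ENNReal.coe_ofNat, ENNReal.rpow_ofNat] at h1
  have h2 : ∀ ξ, ‖zakSeries θ D ξ‖ₑ ^ 2 = ‖c θ‖ₑ ^ 2 * ‖D (circleMap (freq θ) ξ)‖ₑ ^ 2 := by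
    intro ξ
    rw [← mul_pow, ← enorm_mul, ← ofReal_norm, ← ofReal_norm, norm_zakSeries, norm_mul]
  simp_rw [h1, h2]
  rw [lintegral_const_mul' _ _ (by finiteness), mul_pow, enorm_sq_eq_lintegral, ENNReal.coe_mul,
    mul_pow, mul_assoc, ← ENNReal.coe_pow (NNReal.sqrt M), NNReal.sq_sqrt]
  exact mul_le_mul' le_rfl (hM _ (measurable_enorm_sq D))

/-- The chirp `λ_θ(n)` cancels the part of `conj K` quadratic in `n`; what remains is a factor
independent of `n` times a character of the circle. -/
lemma zak_term_eq (n : ℤ) (ξ : ℝ) :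
    modulate θ φ (σ - n) * chirp θ n * conj (K θ n ξ) =
      conj (c θ) * conj (chirp θ ξ) *
        (modulate θ φ (σ - n) * fourier (-n) (circleMap (freq θ) ξ)) := by
  have h1 : chirp θ n * conj (K θ n ξ) =
      conj (c θ) * conj (chirp θ ξ) * fourier (-n) (circleMap (freq θ) ξ) := by
    have hpi : (Real.pi : ℂ) ≠ 0 := by exact_mod_cast Real.pi_ne_zero
    rw [circleMap, fourier_coe_apply, K, chirp, chirp, freq, map_mul, ← Complex.exp_conj,
      ← Complex.exp_conj, mul_left_comm, ← Complex.exp_add,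
      mul_assoc (conj (c θ)), ← Complex.exp_add]
    congr 2
    simp only [map_sub, map_mul, Complex.conj_I, Complex.conj_ofReal]
    push_cast
    field_simp
    ring
  rw [mul_assoc, h1]
  ring

lemma isZak_zakSeries (hθ : Real.sin θ ≠ 0) (hC : C θ φ σ < ∞) :
    IsZak θ φ σ (zakSeries θ (symbol hC)) := by
  refine ⟨(measurable_zakSeries _).aestronglyMeasurable, fun R => ?_⟩
  obtain ⟨M, hM⟩ := exists_eLpNorm_zakSeries_le hθ R
  -- The Zak series runs over `σ - n` and the symbol over `σ + n`.
  have h1 := (Equiv.neg ℤ).hasSum_iff.2 (hasSum_symbol hC)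
  have h2 : Tendsto (fun s : Finset ℤ => M * ‖∑ n ∈ s, modulate θ φ (σ - n) •
      (fourierBasis (-n) : CircleL2) - symbol hC‖ₑ) atTop (𝓝 0) := by
    have h3 : Tendsto (fun s : Finset ℤ => ∑ n ∈ s, modulate θ φ (σ - n) •
        (fourierBasis (-n) : CircleL2) - symbol hC) atTop (𝓝 0) := by
      rw [← sub_self (symbol hC)]
      refine Tendsto.sub_const ?_ _
      refine Tendsto.congr (fun s => Finset.sum_congr rfl fun n _ => ?_) h1
      simp [sub_eq_add_neg]
    have h4 := ENNReal.Tendsto.const_mul (a := (M : ℝ≥0∞)) h3.enorm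
      (Or.inr ENNReal.coe_ne_top)
    simpa using h4
  refine tendsto_of_tendsto_of_tendsto_of_le_of_le tendsto_const_nhds h2 (fun _ => zero_le)
    fun s => ?_
  refine le_of_eq_of_le (eLpNorm_congr_ae (ae_restrict_of_ae ?_)) (hM _)
  have h5 : ∀ᵐ x ∂AddCircle.haarAddCircle, (∑ n ∈ s, modulate θ φ (σ - n) •
      (fourierBasis (-n) : CircleL2) - symbol hC : CircleL2) x =
        ∑ n ∈ s, modulate θ φ (σ - n) * fourier (-n) x - symbol hC x := by
    have h6 : ∀ n : ℤ, ∀ᵐ x ∂AddCircle.haarAddCircle, (modulate θ φ (σ - n) •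
        (fourierBasis (-n) : CircleL2) : CircleL2) x =
          modulate θ φ (σ - n) * (fourierBasis (-n) : CircleL2) x := fun n => Lp.coeFn_smul _ _
    have h7 : ∀ n : ℤ, ∀ᵐ x ∂AddCircle.haarAddCircle,
        (fourierBasis (-n) : CircleL2) x = fourier (-n) x := fun n => coeFn_fourierBasis (-n)
    filter_upwards [Lp.coeFn_sub (∑ n ∈ s, modulate θ φ (σ - n) •
      (fourierBasis (-n) : CircleL2)) (symbol hC), Lp.coeFn_finsetSum s
      (fun n : ℤ => (modulate θ φ (σ - n) • (fourierBasis (-n) : CircleL2) : CircleL2)),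
      ae_all_iff.2 h6, ae_all_iff.2 h7] with x h8 h9 h10 h11
    rw [h8, Pi.sub_apply, h9, Finset.sum_apply]
    congr 1
    exact Finset.sum_congr rfl fun n _ => by rw [h10, h11]
  filter_upwards [ae_circleMap (freq_ne_zero hθ) h5] with ξ hξ
  simp only [zakSeries, hξ, zak_term_eq]
  rw [mul_sub, Finset.mul_sum]

lemma continuous_K (n : ℝ) : Continuous (K θ n) := by
  unfold K
  fun_prop

/-- Both functions are limits of the same partial sums on each bounded interval, and countably many
intervals exhaust the line. Results for `zakSeries` thereby transfer to the chosen `zak`. -/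
lemma IsZak.ae_eq {z z' : ℝ → ℂ} (h : IsZak θ φ σ z) (h' : IsZak θ φ σ z') : z =ᵐ[volume] z' := by
  have key : ∀ R : ℝ, z =ᵐ[volume.restrict (Set.Icc (-R) R)] z' := by
    intro R
    set μ := volume.restrict (Set.Icc (-R) R)
    have hz : AEStronglyMeasurable z μ := h.1.restrict
    have hz' : AEStronglyMeasurable z' μ := h'.1.restrict
    have h0 : eLpNorm (z - z') 2 μ ≤ 0 := by
      have h1 := (h'.2 R).add (h.2 R)
      rw [add_zero] at h1
      refine ge_of_tendsto h1 (Eventually.of_forall fun s => ?_)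
      set f : ℝ → ℂ := fun ξ => ∑ n ∈ s, modulate θ φ (σ - n) * chirp θ n * conj (K θ n ξ) with hf
      have hfm : AEStronglyMeasurable f μ := by
        refine Continuous.aestronglyMeasurable ?_
        refine continuous_finsetSum s fun n _ => continuous_const.mul ?_
        exact Complex.continuous_conj.comp (continuous_K _)
      have h2 : z - z' = (f - z') - (f - z) := by ring
      rw [h2]
      exact eLpNorm_sub_le (hfm.sub hz') (hfm.sub hz) one_le_two
    have h3 := (eLpNorm_eq_zero_iff (hz.sub hz') two_ne_zero).1 (le_antisymm h0 zero_le)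
    filter_upwards [h3] with ξ hξ
    exact sub_eq_zero.1 hξ
  have h1 : ∀ N : ℕ, ∀ᵐ ξ : ℝ, ξ ∈ Set.Icc (-(N : ℝ)) N → z ξ = z' ξ := fun N =>
    (ae_restrict_iff' measurableSet_Icc).1 (key N)
  filter_upwards [ae_all_iff.2 h1] with ξ hξ
  obtain ⟨N, hN⟩ := exists_nat_ge |ξ|
  exact hξ N (abs_le.1 hN)

lemma zak_ae_eq (hθ : Real.sin θ ≠ 0) (hC : C θ φ σ < ∞) :
    zak θ φ σ =ᵐ[volume] zakSeries θ (symbol hC) := by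
  have h : ∃ z, IsZak θ φ σ z := ⟨_, isZak_zakSeries hθ hC⟩
  rw [zak, dif_pos h]
  exact h.choose_spec.ae_eq (isZak_zakSeries hθ hC)

lemma ae_zak_bounds_iff (hθ : Real.sin θ ≠ 0) (hC : C θ φ σ < ∞) (α β : ℝ) :
    (∀ᵐ ξ ∂(volume.restrict (Set.Icc 0 (Δ θ))), α ≤ ‖zak θ φ σ ξ‖ ∧ ‖zak θ φ σ ξ‖ ≤ β) ↔
      ∀ᵐ x ∂AddCircle.haarAddCircle,
        α ≤ ‖c θ‖ * ‖symbol hC x‖ ∧ ‖c θ‖ * ‖symbol hC x‖ ≤ β := by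
  have hm : Measurable fun x => ‖c θ‖ * ‖symbol hC x‖ :=
    (Lp.stronglyMeasurable (symbol hC)).measurable.norm.const_mul _
  rw [← ae_restrict_circleMap_iff (freq_ne_zero hθ) (Δ_eq θ)
    (p := fun x => α ≤ ‖c θ‖ * ‖symbol hC x‖ ∧ ‖c θ‖ * ‖symbol hC x‖ ≤ β)
    ((measurableSet_le measurable_const hm).inter (measurableSet_le hm measurable_const))]
  have h1 := ae_restrict_of_ae (s := Set.Icc 0 (Δ θ)) (zak_ae_eq hθ hC)
  constructor <;> intro h <;> filter_upwards [h, h1] with ξ h2 h3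
  · rwa [h3, norm_zakSeries] at h2
  · rwa [h3, norm_zakSeries]

end Zak

/-! ### Sampling in `V_θ(φ)` -/

section Main

variable {θ : ℝ} {φ : ℝ → ℂ} (hφ : MemLp φ 2 volume) {A B : ℝ}
  (hF : PeriodizationBounds (chirpFourier θ (hφ.toLp φ)) A B) (hC : ∀ t, C θ φ t < ∞)
  (hA : 0 < A) (hB : 0 ≤ B) {σ : ℝ}

lemma isSamplingExpansion_iff (s : ℤ → CircleL2) :
    IsSamplingExpansion θ hφ σ (fun n => synthEquiv hφ hF hA hB (s n)) ↔
      IsExpansion (kernel hC) (fun n : ℤ => σ + n) s := by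
  unfold IsSamplingExpansion IsExpansion
  rw [(synthEquiv hφ hF hA hB).surjective.forall]
  simp_rw [value_synthEquiv hφ hF hC hA hB]

/-- By Cauchy–Schwarz the error at `t` is at most `‖kernel t‖` times the `L²` error, and `‖kernel
t‖² = |c(θ)|² C(t)` is bounded on `E`. -/
lemma tendstoUniformlyOn_of_hasSum (s : ℤ → CircleL2) (d : ℤ → ℂ) (D : CircleL2)
    (h : HasSum (fun n => d n • s n) D) {E : Set ℝ} {M : ℝ≥0} (hM : ∀ t ∈ E, C θ φ t ≤ M) :
    TendstoUniformlyOn (fun (u : Finset ℤ) (t : ℝ) => ∑ n ∈ u, d n * inner ℂ (kernel hC t) (s n))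
      (fun t => inner ℂ (kernel hC t) D) atTop E := by
  rw [Metric.tendstoUniformlyOn_iff]
  intro ε hε
  set N : ℝ := ‖c θ‖ * √M + 1 with hN
  have hN0 : 0 < N := by positivity
  have hk : ∀ t ∈ E, ‖kernel hC t‖ ≤ N := fun t ht => by
    have h1 : (C θ φ t).toReal ≤ M := ENNReal.toReal_le_coe_of_le_coe (hM t ht)
    have h2 : ‖kernel hC t‖ ^ 2 ≤ (‖c θ‖ * √M) ^ 2 := by
      rw [norm_kernel_sq, mul_pow, Real.sq_sqrt M.coe_nonneg]
      gcongr
    have := abs_le_of_sq_le_sq h2 (by positivity)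
    linarith [(le_abs_self _).trans this]
  filter_upwards [Metric.tendsto_nhds.1 h (ε / N) (by positivity)] with u hu t ht
  have h3 : ∑ n ∈ u, d n * inner ℂ (kernel hC t) (s n) =
      inner ℂ (kernel hC t) (∑ n ∈ u, d n • s n) := by
    rw [inner_sum]
    simp_rw [inner_smul_right]
  rw [dist_comm, h3, dist_eq_norm, ← inner_sub_right]
  rw [dist_eq_norm, lt_div_iff₀ hN0] at hu
  refine (norm_inner_le_norm _ _).trans_lt (lt_of_le_of_lt ?_ hu)
  rw [mul_comm]
  exact mul_le_mul_of_nonneg_left (hk t ht) (norm_nonneg _)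

lemma frft_synthEquiv (hθ : Real.sin θ ≠ 0) (D : CircleL2) :
    ∀ᵐ ξ : ℝ, frft θ (synthEquiv hφ hF hA hB D : Lp ℂ 2 (volume : Measure ℝ)) ξ =
      c θ * D (circleMap (freq θ) ξ) * frft θ (hφ.toLp φ) ξ := by
  have hκ : b θ / (2 * Real.pi) ≠ 0 :=
    div_ne_zero (inv_ne_zero hθ) (mul_ne_zero two_ne_zero Real.pi_ne_zero)
  have h1 : ∀ᵐ w : ℝ, chirpFourier θ (synth hφ hF hB D) w =
      c θ * (D (circleMap (-1) w) * chirpFourier θ (hφ.toLp φ) w) := by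
    rw [chirpFourier_synth]
    filter_upwards [Lp.coeFn_smul (c θ) (periodicMul hF hB D), coeFn_periodicMul hF hB D]
      with w h2 h3
    rw [h2, Pi.smul_apply, h3, smul_eq_mul]
  filter_upwards [(ae_comp_mul_iff hκ).2 h1] with ξ hξ
  have e1 : b θ / (2 * Real.pi) * ξ = b θ * ξ / (2 * Real.pi) := by ring
  have e2 : circleMap (-1) (b θ / (2 * Real.pi) * ξ) = circleMap (freq θ) ξ := by
    simp only [circleMap, freq]
    congr 1
    ring
  rw [e2, e1] at hξ
  rw [frft_eq, frft_eq, coe_synthEquiv, hξ]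
  ring

/-- Up to the factors `η_θ`, the `n`-th interpolating function is the zeroth one multiplied by the
`n`-th character, hence a chirp-modulated translate of it. -/
lemma value_dual {a₀ : ℝ} (ha : 0 < a₀)
    (hP : ∀ᵐ x ∂AddCircle.haarAddCircle, a₀ ≤ ‖symbol (hC σ) x‖) (n : ℤ) (t : ℝ) :
    inner ℂ (kernel hC t) ((samplingSystem hφ hF hC hA hB).dual ha hP n) =
      conj (chirp θ t) * chirp θ (σ + n) * chirp θ (t - n) *
        (conj (chirp θ σ) * inner ℂ (kernel hC (t - n))
          ((samplingSystem hφ hF hC hA hB).dual ha hP 0)) := by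
  set S := samplingSystem (σ := σ) hφ hF hC hA hB
  have h1 : (eta θ (σ + n)) • S.dual ha hP n =
      (eta θ σ) • mulL (memLp_fourier n) (S.dual ha hP 0) := by
    have hw : ∀ m : ℤ, eta θ (σ + m) • S.dual ha hP m =
        mulL (S.memLp_inv ha hP) (fourierBasis m) := fun m => by
      rw [SamplingSystem.dual, map_smul, smul_smul, mul_inv_cancel₀ (S.w_ne_zero m), one_smul]
    have h0 := hw 0
    rw [Int.cast_zero, add_zero] at h0
    rw [hw, ← map_smul, h0]
    refine Lp.ext ?_
    filter_upwards [coeFn_mulL (S.memLp_inv ha hP) (fourierBasis n),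
      coeFn_mulL (S.memLp_inv ha hP) (fourierBasis 0),
      coeFn_mulL (memLp_fourier n) (mulL (S.memLp_inv ha hP) (fourierBasis 0)),
      coeFn_fourierBasis n, coeFn_fourierBasis 0] with x h1 h2 h3 h4 h5
    rw [h1, h3, h2, h4, h5, fourier_zero, mul_one, mul_comm]
  have h2 := congrArg (fun D => inner ℂ (kernel hC t) D) h1
  simp only [inner_smul_right] at h2
  have h3 := inner_kernel_mulL_fourier hC (S.dual ha hP 0) n t
  set x := inner ℂ (kernel hC t) (S.dual ha hP n)
  set y := inner ℂ (kernel hC t) (mulL (memLp_fourier n) (S.dual ha hP 0))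
  set z := inner ℂ (kernel hC (t - n)) (S.dual ha hP 0)
  have hc := c_ne_zero θ
  simp only [eta] at h2 h3
  have h2' : conj (chirp θ (σ + n)) * x = conj (chirp θ σ) * y :=
    mul_left_cancel₀ hc (by linear_combination h2)
  have h3' : conj (chirp θ (t - n)) * y = conj (chirp θ t) * z :=
    mul_left_cancel₀ hc (by linear_combination h3)
  have e1 := chirp_mul_conj θ (σ + n)
  have e2 := chirp_mul_conj θ (t - n)
  calc x = chirp θ (σ + n) * (conj (chirp θ (σ + n)) * x) := by rw [← mul_assoc, e1, one_mul]
    _ = chirp θ (σ + n) * conj (chirp θ σ) *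
        (chirp θ (t - n) * (conj (chirp θ (t - n)) * y)) := by
      rw [h2', ← mul_assoc (chirp θ (t - n)), e2]; ring
    _ = _ := by rw [h3']; ring

lemma isExpansion_dual {a₀ b₀ : ℝ} (ha : 0 < a₀)
    (hP : ∀ᵐ x ∂AddCircle.haarAddCircle, a₀ ≤ ‖symbol (hC σ) x‖)
    (hP' : ∀ᵐ x ∂AddCircle.haarAddCircle, ‖symbol (hC σ) x‖ ≤ b₀) :
    IsExpansion (kernel hC) (fun n : ℤ => σ + n)
      ((samplingSystem hφ hF hC hA hB).dual ha hP) := fun D t => by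
  have h := (innerSL ℂ (kernel hC t)).hasSum
    ((samplingSystem hφ hF hC hA hB).hasSum_sample_smul_dual ha hP hP' D)
  simpa only [innerSL_apply_apply, inner_smul_right] using h

/-- A frame or Riesz basis with a sampling expansion is the interpolating one, and the Fourier
series of the samples is bounded above and below. -/
lemma exists_bounds_of_isSamplingExpansion {S : ℤ → V θ hφ} (hS : IsFrame S ∨ IsRieszBasis S)
    (hexp : IsSamplingExpansion θ hφ σ S) :
    ∃ (a₀ b₀ : ℝ) (ha : 0 < a₀)
      (hP : ∀ᵐ x ∂AddCircle.haarAddCircle, a₀ ≤ ‖symbol (hC σ) x‖),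
      (∀ᵐ x ∂AddCircle.haarAddCircle, ‖symbol (hC σ) x‖ ≤ b₀) ∧
      S = fun n => synthEquiv hφ hF hA hB ((samplingSystem hφ hF hC hA hB).dual ha hP n) := by
  set Ψ := synthEquiv hφ hF hA hB with hΨ
  set T := samplingSystem (σ := σ) hφ hF hC hA hB
  set s : ℤ → CircleL2 := fun n => Ψ.symm (S n) with hs
  have hSs : S = fun n => Ψ (s n) := by
    ext1 n
    simp [hs]
  rw [hSs, hΨ, isSamplingExpansion_iff hφ hF hC] at hexp
  have hs' : IsFrame s ∨ IsRieszBasis s := hS.imp (fun h => h.map Ψ.symm) (fun h => h.map Ψ.symm)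
  obtain ⟨M, hM, hb⟩ : ∃ M, 0 < M ∧ IsBessel s M :=
    hs'.elim (fun h => h.exists_isBessel) (fun h => h.exists_isBessel)
  -- The order matters: the lower bound for the symbol is what defines the interpolating functions,
  -- and the upper bound is extracted only after `s` is identified with them.
  obtain ⟨a₀, ha, hP⟩ := T.exists_le_norm_of_isBessel hexp hM hb
  have hd : s = T.dual ha hP := T.eq_dual_of_isExpansion ha hP hexp
  rw [hd] at hs'
  obtain ⟨b₀, hP'⟩ := hs'.elim (T.exists_norm_le_of_isFrame ha hP)
    (T.exists_norm_le_of_isRieszBasis ha hP)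
  exact ⟨a₀, b₀, ha, hP, hP', by rw [hSs, hd]⟩

lemma exists_isFrame_isRieszBasis
    (hF : PeriodizationBounds (chirpFourier θ (hφ.toLp φ)) A B) (hC : ∀ t, C θ φ t < ∞)
    (hA : 0 < A) (hB : 0 ≤ B) {a₀ b₀ : ℝ} (ha : 0 < a₀)
    (hP : ∀ᵐ x ∂AddCircle.haarAddCircle, a₀ ≤ ‖symbol (hC σ) x‖)
    (hP' : ∀ᵐ x ∂AddCircle.haarAddCircle, ‖symbol (hC σ) x‖ ≤ b₀) :
    ∃ S : ℤ → V θ hφ, IsFrame S ∧ IsRieszBasis S ∧ IsSamplingExpansion θ hφ σ S := by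
  set T := samplingSystem (σ := σ) hφ hF hC hA hB
  exact ⟨fun n => synthEquiv hφ hF hA hB (T.dual ha hP n),
    (T.isFrame_dual ha hP hP').map (synthEquiv hφ hF hA hB),
    (T.isRieszBasis_dual ha hP hP').map (synthEquiv hφ hF hA hB),
    (isSamplingExpansion_iff hφ hF hC hA hB _).2 (isExpansion_dual hφ hF hC hA hB ha hP hP')⟩

lemma ae_zak_bounds_of_isSamplingExpansion
    (hF : PeriodizationBounds (chirpFourier θ (hφ.toLp φ)) A B) (hC : ∀ t, C θ φ t < ∞)
    (hA : 0 < A) (hB : 0 ≤ B) (hθ : Real.sin θ ≠ 0) {S : ℤ → V θ hφ}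
    (hS : IsFrame S ∨ IsRieszBasis S) (hexp : IsSamplingExpansion θ hφ σ S) :
    ∃ α β : ℝ, 0 < α ∧ α ≤ β ∧ ∀ᵐ ξ ∂(volume.restrict (Set.Icc 0 (Δ θ))),
      α ≤ ‖zak θ φ σ ξ‖ ∧ ‖zak θ φ σ ξ‖ ≤ β := by
  obtain ⟨a₀, b₀, ha, hP, hP', -⟩ :=
    exists_bounds_of_isSamplingExpansion hφ hF hC hA hB hS hexp
  have hc := norm_pos_iff.2 (c_ne_zero θ)
  refine ⟨‖c θ‖ * a₀, max (‖c θ‖ * a₀) (‖c θ‖ * b₀), by positivity, le_max_left _ _, ?_⟩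
  rw [ae_zak_bounds_iff hθ (hC σ)]
  filter_upwards [hP, hP'] with x h1 h2
  exact ⟨mul_le_mul_of_nonneg_left h1 hc.le,
    (mul_le_mul_of_nonneg_left h2 hc.le).trans (le_max_right _ _)⟩

lemma ae_symbol_bounds_of_zak (hθ : Real.sin θ ≠ 0) {α β : ℝ} (hα : 0 < α)
    (h : ∀ᵐ ξ ∂(volume.restrict (Set.Icc 0 (Δ θ))),
      α ≤ ‖zak θ φ σ ξ‖ ∧ ‖zak θ φ σ ξ‖ ≤ β) :
    ∃ a₀ b₀ : ℝ, 0 < a₀ ∧ (∀ᵐ x ∂AddCircle.haarAddCircle, a₀ ≤ ‖symbol (hC σ) x‖) ∧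
      ∀ᵐ x ∂AddCircle.haarAddCircle, ‖symbol (hC σ) x‖ ≤ b₀ := by
  have hc := norm_pos_iff.2 (c_ne_zero θ)
  rw [ae_zak_bounds_iff hθ (hC σ)] at h
  refine ⟨α / ‖c θ‖, β / ‖c θ‖, by positivity, ?_, ?_⟩ <;> filter_upwards [h] with x hx
  · rw [div_le_iff₀ hc, mul_comm]; exact hx.1
  · rw [le_div_iff₀ hc, mul_comm]; exact hx.2

/-- The factor `conj λ_θ(σ)` normalizes the zeroth interpolating function to `1 / (c(θ) P)`, whose
synthesis has transform `φ̂_θ / P(κ ξ)`; and `λ_θ(ξ) Z(σ, ξ) = conj c(θ) P(κ ξ)`. -/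
lemma frft_dual (hθ : Real.sin θ ≠ 0) {a₀ : ℝ} (ha : 0 < a₀)
    (hP : ∀ᵐ x ∂AddCircle.haarAddCircle, a₀ ≤ ‖symbol (hC σ) x‖) :
    ∀ᵐ ξ : ℝ, frft θ (synthEquiv hφ hF hA hB
        (conj (chirp θ σ) • (samplingSystem hφ hF hC hA hB).dual ha hP 0) :
          Lp ℂ 2 (volume : Measure ℝ)) ξ =
      conj (c θ) * frft θ (hφ.toLp φ) ξ / (chirp θ ξ * zak θ φ σ ξ) := by
  set S := samplingSystem (σ := σ) hφ hF hC hA hB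
  have hc := c_ne_zero θ
  have h0 : ∀ᵐ x ∂AddCircle.haarAddCircle,
      (conj (chirp θ σ) • S.dual ha hP 0 : CircleL2) x * (c θ * symbol (hC σ) x) = 1 ∧
        symbol (hC σ) x ≠ 0 := by
    filter_upwards [Lp.coeFn_smul (conj (chirp θ σ)) (S.dual ha hP 0), hP, S.dual_mul ha hP 0,
      Lp.coeFn_smul (eta θ (σ + (0 : ℤ)))⁻¹ (fourierBasis 0 : CircleL2),
      coeFn_fourierBasis 0] with x h1 h2 h3 h4 h5
    rw [h4, Pi.smul_apply, h5, fourier_zero, smul_eq_mul, mul_one, Int.cast_zero, add_zero,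
      eta] at h3
    refine ⟨?_, fun h6 => by rw [h6, norm_zero] at h2; linarith⟩
    have hne : c θ * conj (chirp θ σ) ≠ 0 :=
      mul_ne_zero hc ((map_ne_zero _).2 (chirp_ne_zero θ σ))
    rw [h1, Pi.smul_apply, smul_eq_mul]
    calc _ = c θ * conj (chirp θ σ) * (S.dual ha hP 0 x * symbol (hC σ) x) := by ring
      _ = 1 := by rw [← h3, mul_inv_cancel₀ hne]
  filter_upwards [frft_synthEquiv hφ hF hA hB hθ (conj (chirp θ σ) • S.dual ha hP 0),
    zak_ae_eq hθ (hC σ), ae_circleMap (freq_ne_zero hθ) h0] with ξ h1 h2 h3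
  obtain ⟨h3, h4⟩ := h3
  have h5 : chirp θ ξ * zak θ φ σ ξ = conj (c θ) * symbol (hC σ) (circleMap (freq θ) ξ) := by
    rw [h2, zakSeries]
    linear_combination conj (c θ) * symbol (hC σ) (circleMap (freq θ) ξ) * chirp_mul_conj θ ξ
  have hcc : conj (c θ) ≠ 0 := (map_ne_zero _).2 hc
  rw [h1, h5, mul_div_mul_left _ _ hcc, eq_div_iff h4]
  linear_combination frft θ (hφ.toLp φ) ξ * h3

end Main

end

end FrFT

theorem mainTheorem1 (θ : ℝ) (hθ : Real.sin θ ≠ 0) (φ : ℝ → ℂ) (hφ : MemLp φ 2 volume)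
    (A B : ℝ) (hA : 0 < A) (hAB : A ≤ B)
    (hG : ∀ᵐ ξ ∂(volume.restrict (Set.Icc 0 (FrFT.Δ θ))),
      ENNReal.ofReal A ≤ FrFT.G θ hφ ξ ∧ FrFT.G θ hφ ξ ≤ ENNReal.ofReal B)
    (hC : ∀ t, FrFT.C θ φ t < ∞)
    (σ : ℝ) (hσ0 : 0 ≤ σ) (hσ1 : σ < 1) :
    -- point values in `V_θ(φ)` and the Zak transform at `σ` are well defined
    (∀ f : FrFT.V θ hφ, ∃! g : ℝ → ℂ, FrFT.Represents θ hφ f g) ∧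
    (∃ z, FrFT.IsZak θ φ σ z) ∧
    -- the equivalence
    List.TFAE [
      ∃ S : ℤ → FrFT.V θ hφ, FrFT.IsFrame S ∧ FrFT.IsSamplingExpansion θ hφ σ S,
      ∃ S : ℤ → FrFT.V θ hφ, FrFT.IsRieszBasis S ∧ FrFT.IsSamplingExpansion θ hφ σ S,
      ∃ α β : ℝ, 0 < α ∧ α ≤ β ∧ ∀ᵐ ξ ∂(volume.restrict (Set.Icc 0 (FrFT.Δ θ))),
        α ≤ ‖FrFT.zak θ φ σ ξ‖ ∧ ‖FrFT.zak θ φ σ ξ‖ ≤ β] ∧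
    -- every frame and every Riesz basis with a sampling expansion
    ∀ S : ℤ → FrFT.V θ hφ, FrFT.IsFrame S ∨ FrFT.IsRieszBasis S →
      FrFT.IsSamplingExpansion θ hφ σ S →
      -- convergence in `L²(ℝ)`
      (∀ f : FrFT.V θ hφ, HasSum (fun n : ℤ => FrFT.value θ hφ f (σ + n) • S n) f) ∧
      -- uniform convergence where `C_{φ,θ}` is bounded
      (∀ (f : FrFT.V θ hφ) (E : Set ℝ), (∃ M : ℝ≥0, ∀ t ∈ E, FrFT.C θ φ t ≤ M) →
        TendstoUniformlyOn
          (fun (s : Finset ℤ) (t : ℝ) =>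
            ∑ n ∈ s, FrFT.value θ hφ f (σ + n) * FrFT.value θ hφ (S n) t)
          (FrFT.value θ hφ f) atTop E) ∧
      -- the form of the `S n`
      (∃ S₀ : FrFT.V θ hφ,
        (∀ᵐ ξ : ℝ, FrFT.frft θ (S₀ : Lp ℂ 2 (volume : Measure ℝ)) ξ =
          conj (FrFT.c θ) * FrFT.frft θ (hφ.toLp φ) ξ /
            (FrFT.chirp θ ξ * FrFT.zak θ φ σ ξ)) ∧
        ∀ (n : ℤ) (t : ℝ), FrFT.value θ hφ (S n) t =
          conj (FrFT.chirp θ t) * FrFT.chirp θ (σ + n) * FrFT.chirp θ (t - n) *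
            FrFT.value θ hφ S₀ (t - n)) ∧
      -- interpolation
      (∀ n k : ℤ, FrFT.value θ hφ (S n) (σ + k) = if n = k then 1 else 0) := by
  classical
  have hc := norm_pos_iff.2 (FrFT.c_ne_zero θ)
  have hF := FrFT.periodizationBounds hφ hθ hG
  have hA' : 0 < A / ‖FrFT.c θ‖ ^ 2 := by positivity
  have hB' : 0 ≤ B / ‖FrFT.c θ‖ ^ 2 := by have := hA.le.trans hAB; positivity
  refine ⟨FrFT.existsUnique_represents hφ hF hC hA' hB',
    ⟨_, FrFT.isZak_zakSeries hθ (hC σ)⟩, ?_, ?_⟩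
  · have h31 : (∃ α β : ℝ, 0 < α ∧ α ≤ β ∧ ∀ᵐ ξ ∂(volume.restrict (Set.Icc 0 (FrFT.Δ θ))),
        α ≤ ‖FrFT.zak θ φ σ ξ‖ ∧ ‖FrFT.zak θ φ σ ξ‖ ≤ β) →
        ∃ S : ℤ → FrFT.V θ hφ,
          FrFT.IsFrame S ∧ FrFT.IsRieszBasis S ∧ FrFT.IsSamplingExpansion θ hφ σ S := by
      rintro ⟨α, β, hα, -, h⟩
      obtain ⟨a₀, b₀, ha, hP, hP'⟩ := FrFT.ae_symbol_bounds_of_zak hC hθ hα h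
      exact FrFT.exists_isFrame_isRieszBasis hφ hF hC hA' hB' ha hP hP'
    tfae_have 1 → 3 := fun ⟨S, hS, h⟩ =>
      FrFT.ae_zak_bounds_of_isSamplingExpansion hφ hF hC hA' hB' hθ (Or.inl hS) h
    tfae_have 2 → 3 := fun ⟨S, hS, h⟩ =>
      FrFT.ae_zak_bounds_of_isSamplingExpansion hφ hF hC hA' hB' hθ (Or.inr hS) h
    tfae_have 3 → 1 := fun h => by
      obtain ⟨S, h1, h2, h3⟩ := h31 h
      exact ⟨S, h1, h3⟩
    tfae_have 3 → 2 := fun h => by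
      obtain ⟨S, h1, h2, h3⟩ := h31 h
      exact ⟨S, h2, h3⟩
    tfae_finish
  · intro S hS hexp
    obtain ⟨a₀, b₀, ha, hP, hP', rfl⟩ :=
      FrFT.exists_bounds_of_isSamplingExpansion hφ hF hC hA' hB' hS hexp
    set T := FrFT.samplingSystem (σ := σ) hφ hF hC hA' hB'
    set Ψ := FrFT.synthEquiv hφ hF hA' hB' with hΨ
    have hv : ∀ D t, FrFT.value θ hφ (Ψ D) t = inner ℂ (FrFT.kernel hC t) D :=
      FrFT.value_synthEquiv hφ hF hC hA' hB'
    refine ⟨fun f => ?_, fun f E ⟨M, hM⟩ => ?_, ?_, fun n k => ?_⟩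
    · obtain ⟨D, rfl⟩ := Ψ.surjective f
      have h := (Ψ : _ →L[ℂ] FrFT.V θ hφ).hasSum (T.hasSum_sample_smul_dual ha hP hP' D)
      simpa only [hv, ContinuousLinearEquiv.coe_coe, map_smul] using h
    · obtain ⟨D, rfl⟩ := Ψ.surjective f
      have h := FrFT.tendstoUniformlyOn_of_hasSum hC _ _ _
        (T.hasSum_sample_smul_dual ha hP hP' D) hM
      rw [show FrFT.value θ hφ (Ψ D) = fun t => inner ℂ (FrFT.kernel hC t) D from funext (hv D)]
      simpa only [hv] using h
    · refine ⟨Ψ (conj (FrFT.chirp θ σ) • T.dual ha hP 0),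
        FrFT.frft_dual hφ hF hC hA' hB' hθ ha hP, fun n t => ?_⟩
      rw [hv, hv, inner_smul_right]
      exact FrFT.value_dual hφ hF hC hA' hB' ha hP n t
    · rw [hv]
      exact T.sample_dual ha hP n k
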